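/- **Setting.** Let $Q$ be a smooth finite-dimensional manifold, $L_d:Q\times Q\to\mathbb R$ smooth (discrete lagrangian), $\mathcal D\subset TQ$ a smooth subbundle (variational constraints) and $\mathcal D_d\subset Q\times Q$ a submanifold (kinematic constraints). A discrete curve $q_\cdot=(q_0,\dots,q_N)$ in $Q$ is a *trajectory* of $(Q,L_d,\mathcal D,\mathcal D_d)$ if $(q_k,q_{k+1})\in\mathcal D_d$ for $0\le k<N$ and $\sum_{k=0}^{N-1}dL_d(q_k,q_{k+1})(\delta q_k,\delta q_{k+1})=0$ for all $\delta q_k\in\mathcal D_{q_k}$ with $\delta q_0=0$, $\delta q_N=0$. For a system with a force $f_d$ (a $1$-form on $Q\times Q$) the second condition is replaced by $\sum_k (dL_d+f_d)(q_k,q_{k+1})(\delta q_k,\delta q_{k+1})=0$ for the same variations. Let $M$ be a Lie group acting smoothly, freely and properly on $Q$ and leaving $L_d$, $\mathcal D$, $\mathcal D_d$ invariant, and let $G\subset M$ be a closed subgroup with $T_q(Mq)\cap\mathcal D_q=T_q(Gq)=:\mathcal V^G_q$ for all $q\in Q$ ($G$ is a *horizontal symmetry group*). Then $\pi:Q\to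 Q/G$ is a principal $G$-bundle. Let $\mathfrak g$ be the Lie algebra of $G$, $\xi_Q$ the infinitesimal generator of $\xi\in\mathfrak g$, and let $J_d:Q\times Q\to\mathfrak g^*$ be $J_d(q_0,q_1)\xi=-D_1L_d(q_0,q_1)\xi_Q(q_0)$. For $\mu\in\mathfrak g^*$ put $\mathcal J_\mu=J_d^{-1}(\mu)$. $G$ is *$\mu$-good* if, for all $(q_0,q_1)$, the bilinear form $D_2D_1L_d(q_0,q_1)$ is nondegenerate on $T_{q_0}Q\times T_{q_1}Q$ and on $\mathcal V^G_{q_0}\times\mathcal V^G_{q_1}$, and if for every $q$ there is a unique $g\in G$ with $J_d(q,gq)=\mu$. Fix $G$-invariant smooth subbundles $\mathcal H,\mathcal W$ with $\mathcal D=\mathcal V^G\oplus\mathcal H$, $TQ=\mathcal W\oplus\mathcal D$, and let $h_q:T_{\pi(q)}(Q/G)\to \mathcal W_q\oplus\mathcal H_q$ be the horizontal lift of the principal connection with horizontal space $\mathcal W\oplus\mathcal H$. **Discrete horizontal lifts.** Let $\Omega\subset Q\times Q$ be a $G$-invariant open neighbourhood of $\{(q,gq)\in\mathcal J_\mu: q\in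 Q,\ g\in G\}$, and let $\operatorname{dom}$ be the interior of the set of all $(q_0,q_1)$ for which there is a unique $g=:\mathcal A_d(q_0,q_1)\in G$ with $(q_0,g^{-1}q_1)\in\mathcal J_\mu\cap\Omega$. For $r_1\in Q/G$ the discrete horizontal lift $q_1=\overline{h}^{d}_{q_0}(r_1)$ is the point $q_1\in\pi^{-1}(r_1)$ with $(q_0,q_1)\in\mathcal J_\mu\cap\Omega$ (it exists and is unique if $(\pi(q_0),r_1)\in(\pi\times\pi)(\operatorname{dom})$). **Reduced system.** With $\rho:Q\times G\to\widetilde G=(Q\times G)/G$ the quotient by $g(q,w)=(gq,gwg^{-1})$, set $\check L_d(q_0,w_0,r_1)=L_d(q_0,w_0\,\overline h^d_{q_0}(r_1))$, $\hat L_d(\rho(q_0,w_0),r_1)=\check L_d(q_0,w_0,r_1)$, $\hat{\mathcal D}_d=\{(\rho(q_0,\mathcal A_d(q_0,q_1)),\pi(q_1)):(q_0,q_1)\in\mathcal D_d\cap\operatorname{dom}\}$, and $$\hat F_d(\rho(q_0,w_0),r_1)(\delta r_0,\delta r_1)=D_2\check L_d(q_0,w_0,r_1)\,d\mathcal A_d(q_0,q_1)(h_{q_0}\delta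 r_0,h_{q_1}\delta r_1),\quad q_1=w_0\,\overline h^d_{q_0}(r_1).$$ With $\mathcal Y(r_0,r_1)=(\rho(q_0,e),r_1)$, $\pi(q_0)=r_0$, the reduced forced system on $Q/G$ is $(Q/G,\breve L_d,\breve{\mathcal D},\breve{\mathcal D}_d,\breve F_d)$ with $\breve L_d=\hat L_d\circ\mathcal Y$, $\breve{\mathcal D}=d\pi(\mathcal D)$, $\breve{\mathcal D}_d=\mathcal Y^{-1}(\hat{\mathcal D}_d)$, $\breve F_d=\mathcal Y^*\hat F_d$. **Theorem.** Let $(\bar q_0,\bar q_1)\in\mathcal D_d$ and $\mu=J_d(\bar q_0,\bar q_1)$. Assume that $Ad_g^*(\mu)=\mu$ for all $g\in G$, that $G$ is $\mu$-good, and that $(\bar q_0,\bar q_1)\in\Omega$. Let $N\ge1$ and let $r_\cdot=(r_0,\dots,r_N)$ be a trajectory of $(Q/G,\breve L_d,\breve{\mathcal D},\breve{\mathcal D}_d,\breve F_d)$ with $\pi(\bar q_j)=r_j$ for $j=0,1$. Define $q_\cdot$ by $q_0=\bar q_0$ and $q_{k+1}=\overline h^d_{q_k}(r_{k+1})$ for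 $0\le k<N$. Then these lifts exist and are unique, and $q_\cdot$ is a trajectory of $(Q,L_d,\mathcal D,\mathcal D_d)$ with $q_0=\bar q_0$ and $q_1=\bar q_1$. -/

import Mathlib

open scoped Manifold ContDiff Topology

noncomputable section

namespace DiscreteMechanics

/-! ### Subbundles and submanifolds -/

section Manifolds

variable {E : Type*} [NormedAddCommGroup E] [NormedSpace ℝ E]
  {X : Type*} [TopologicalSpace X] [ChartedSpace E X]

/-- A family of subspaces of the tangent spaces of `X` is a smooth subbundle of `TX`: locally it is
spanned by a smooth frame. -/
def IsSmoothSubbundle [IsManifold 𝓘(ℝ, E) ∞ X] (D : ∀ x : X, Submodule ℝ (TangentSpace 𝓘(ℝ, E) x)) : Prop :=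
  ∀ x₀ : X, ∃ O : Set X, IsOpen O ∧ x₀ ∈ O ∧
    ∃ (n : ℕ) (V : Fin n → ∀ x : X, TangentSpace 𝓘(ℝ, E) x),
      (∀ i, ContMDiffOn 𝓘(ℝ, E) 𝓘(ℝ, E).tangent ∞
        (fun x => (⟨x, V i x⟩ : TangentBundle 𝓘(ℝ, E) X)) O) ∧
      ∀ x ∈ O, LinearIndependent ℝ (fun i => V i x) ∧
        Submodule.span ℝ (Set.range fun i => V i x) = D x

/-- `S` is an (embedded) submanifold: locally it is the zero set of a smooth map to some `ℝᵏ` which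
is submersive along `S`. -/
def IsSubmanifold {E' H' : Type*} [NormedAddCommGroup E'] [NormedSpace ℝ E'] [TopologicalSpace H']
    (I : ModelWithCorners ℝ E' H') {Y : Type*} [TopologicalSpace Y] [ChartedSpace H' Y]
    (S : Set Y) : Prop :=
  ∀ y₀ ∈ S, ∃ O : Set Y, IsOpen O ∧ y₀ ∈ O ∧
    ∃ (k : ℕ) (f : Y → (Fin k → ℝ)),
      ContMDiffOn I 𝓘(ℝ, Fin k → ℝ) ∞ f O ∧
      (∀ y ∈ S ∩ O, Function.Surjective (mfderiv I 𝓘(ℝ, Fin k → ℝ) f y)) ∧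
      S ∩ O = {y | y ∈ O ∧ f y = 0}

end Manifolds

/-! ### Discrete mechanical systems and their trajectories -/

section Systems

variable {E : Type*} [NormedAddCommGroup E] [NormedSpace ℝ E]
  {Q : Type*} [TopologicalSpace Q] [ChartedSpace E Q]

/-- The differential of the discrete action `S(q) = ∑ₖ L(qₖ, qₖ₊₁)` at the discrete curve `q`,
evaluated at the variation `δ`. -/
def actionDifferential (L : Q × Q → ℝ) {N : ℕ} (q : Fin (N + 1) → Q)
    (δ : ∀ k, TangentSpace 𝓘(ℝ, E) (q k)) : ℝ :=
  ∑ k : Fin N, mfderiv (𝓘(ℝ, E).prod 𝓘(ℝ, E)) 𝓘(ℝ, ℝ) L (q k.castSucc, q k.succ)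
    ((δ k.castSucc, δ k.succ) : E × E)

/-- The variations `δ` of `q` with vanishing end points and `δₖ ∈ D(qₖ)` for all `k`. -/
def IsAdmissibleVariation (D : ∀ q : Q, Submodule ℝ (TangentSpace 𝓘(ℝ, E) q))
    {N : ℕ} (q : Fin (N + 1) → Q) (δ : ∀ k, TangentSpace 𝓘(ℝ, E) (q k)) : Prop :=
  δ 0 = 0 ∧ δ (Fin.last N) = 0 ∧ ∀ k, δ k ∈ D (q k)

variable (E Q) in
/-- A nonholonomic discrete mechanical system `(Q, L, D, D_d)`. -/
structure DiscreteSystem [IsManifold 𝓘(ℝ, E) ∞ Q] where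
  /-- discrete lagrangian -/
  L : Q × Q → ℝ
  smooth_L : ContMDiff (𝓘(ℝ, E).prod 𝓘(ℝ, E)) 𝓘(ℝ, ℝ) ∞ L
  /-- variational constraints -/
  D : ∀ q : Q, Submodule ℝ (TangentSpace 𝓘(ℝ, E) q)
  subbundle_D : IsSmoothSubbundle D
  /-- discrete kinematic constraints -/
  Dd : Set (Q × Q)
  submanifold_Dd : IsSubmanifold (𝓘(ℝ, E).prod 𝓘(ℝ, E)) Dd

/-- Discrete Lagrange--D'Alembert principle. -/
def DiscreteSystem.IsTrajectory [IsManifold 𝓘(ℝ, E) ∞ Q] (sys : DiscreteSystem E Q) {N : ℕ}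
    (q : Fin (N + 1) → Q) : Prop :=
  (∀ k : Fin N, (q k.castSucc, q k.succ) ∈ sys.Dd) ∧
  ∀ δ : (∀ k, TangentSpace 𝓘(ℝ, E) (q k)), IsAdmissibleVariation sys.D q δ →
    actionDifferential sys.L q δ = 0

variable (E Q) in
/-- The data `(Q, L, D, D_d, f)` of a forced discrete mechanical system that enter the definition of
its trajectories. Here `L` and `f` only matter at the points of `D_d`; in particular this covers
systems whose lagrangian and force are only meaningful on an open set containing `D_d`. -/
structure ForcedData where
  L : Q × Q → ℝ
  D : ∀ q : Q, Submodule ℝ (TangentSpace 𝓘(ℝ, E) q)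
  Dd : Set (Q × Q)
  /-- discrete force: a `1`-form on `Q × Q` -/
  f : ∀ p : Q × Q, TangentSpace (𝓘(ℝ, E).prod 𝓘(ℝ, E)) p →L[ℝ] ℝ

/-- Forced discrete Lagrange--D'Alembert principle. -/
def ForcedData.IsTrajectory (sys : ForcedData E Q) {N : ℕ} (q : Fin (N + 1) → Q) : Prop :=
  (∀ k : Fin N, (q k.castSucc, q k.succ) ∈ sys.Dd) ∧
  ∀ δ : (∀ k, TangentSpace 𝓘(ℝ, E) (q k)), IsAdmissibleVariation sys.D q δ →
    actionDifferential sys.L q δ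
      + ∑ k : Fin N, sys.f (q k.castSucc, q k.succ) ((δ k.castSucc, δ k.succ) : E × E) = 0

/-- `D₁L(q₀, q₁) : T_{q₀}Q → ℝ`. -/
def D₁ (L : Q × Q → ℝ) (q₀ q₁ : Q) : TangentSpace 𝓘(ℝ, E) q₀ →L[ℝ] ℝ :=
  mfderiv 𝓘(ℝ, E) 𝓘(ℝ, ℝ) (fun q => L (q, q₁)) q₀

/-- `D₂D₁L(q₀, q₁) : T_{q₀}Q × T_{q₁}Q → ℝ`. -/
def D₂D₁ (L : Q × Q → ℝ) (q₀ q₁ : Q)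
    (X₀ : TangentSpace 𝓘(ℝ, E) q₀) (X₁ : TangentSpace 𝓘(ℝ, E) q₁) : ℝ :=
  mfderiv 𝓘(ℝ, E) 𝓘(ℝ, ℝ) (fun q => D₁ L q₀ q X₀) q₁ X₁

/-- Regularity of the lagrangian at `(q₀, q₁)`. -/
def IsRegularAt (E : Type*) [NormedAddCommGroup E] [NormedSpace ℝ E] [ChartedSpace E Q]
    (L : Q × Q → ℝ) (q₀ q₁ : Q) : Prop :=
  ∀ X₀ : TangentSpace 𝓘(ℝ, E) q₀,
    (∀ X₁ : TangentSpace 𝓘(ℝ, E) q₁, D₂D₁ L q₀ q₁ X₀ X₁ = 0) → X₀ = 0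

/-- Regularity relative to a distribution `V`: the restriction of `D₂D₁L(q₀, q₁)` to
`V(q₀) × V(q₁)` is nondegenerate. -/
def IsRegularOnAt (L : Q × Q → ℝ) (V : ∀ q : Q, Submodule ℝ (TangentSpace 𝓘(ℝ, E) q))
    (q₀ q₁ : Q) : Prop :=
  (∀ X₀ ∈ V q₀, (∀ X₁ ∈ V q₁, D₂D₁ L q₀ q₁ X₀ X₁ = 0) → X₀ = 0) ∧
  (∀ X₁ ∈ V q₁, (∀ X₀ ∈ V q₀, D₂D₁ L q₀ q₁ X₀ X₁ = 0) → X₁ = 0)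

end Systems

/-! ### Lie group actions, symmetry, momentum -/

section Symmetry

variable {E : Type*} [NormedAddCommGroup E] [NormedSpace ℝ E]
  {Q : Type*} [TopologicalSpace Q] [ChartedSpace E Q] [IsManifold 𝓘(ℝ, E) ∞ Q]
  {F : Type*} [NormedAddCommGroup F] [NormedSpace ℝ F]
  {K : Type*} [Group K] [TopologicalSpace K] [ChartedSpace F K] [MulAction K Q]

/-- `ξ ↦ ξ_Q(q)`, the value at `q` of the infinitesimal generator of `ξ`. -/
def generator (E F : Type*) [NormedAddCommGroup E] [NormedSpace ℝ E] [ChartedSpace E Q]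
    [NormedAddCommGroup F] [NormedSpace ℝ F]
    (K : Type*) [Group K] [TopologicalSpace K] [ChartedSpace F K] [MulAction K Q] (q : Q) :
    GroupLieAlgebra 𝓘(ℝ, F) K →L[ℝ] TangentSpace 𝓘(ℝ, E) q :=
  mfderiv 𝓘(ℝ, F) 𝓘(ℝ, E) (fun g : K => g • q) 1

/-- The vertical space `V(q) = T_q(K · q) = {ξ_Q(q)}`. -/
def verticalSpace (E F : Type*) [NormedAddCommGroup E] [NormedSpace ℝ E] [ChartedSpace E Q]
    [NormedAddCommGroup F] [NormedSpace ℝ F]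
    (K : Type*) [Group K] [TopologicalSpace K] [ChartedSpace F K] [MulAction K Q] (q : Q) :
    Submodule ℝ (TangentSpace 𝓘(ℝ, E) q) :=
  LinearMap.range (generator E F K q).toLinearMap

/-- A distribution is invariant under the lifted action of `K` on `TQ`. -/
def IsInvariantDistribution (K : Type*) [Group K] [MulAction K Q]
    (D : ∀ q : Q, Submodule ℝ (TangentSpace 𝓘(ℝ, E) q)) : Prop :=
  ∀ (g : K) (q : Q), ∀ v ∈ D q, mfderiv 𝓘(ℝ, E) 𝓘(ℝ, E) (fun x : Q => g • x) q v ∈ D (g • q)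

/-- A subset of `Q × Q` is invariant under the diagonal action of `K`. -/
def IsInvariantSet (K : Type*) [Group K] [MulAction K Q] (S : Set (Q × Q)) : Prop :=
  ∀ (g : K), ∀ p ∈ S, (g • p.1, g • p.2) ∈ S

/-- The Lie group `K` acts smoothly, freely and properly on `Q`, and `L`, `D`, `D_d` are
invariant. -/
structure IsSymmetryGroup (F : Type*) [NormedAddCommGroup F] [NormedSpace ℝ F]
    (K : Type*) [Group K] [TopologicalSpace K] [ChartedSpace F K] [MulAction K Q]
    (sys : DiscreteSystem E Q) : Prop where
  smooth : ContMDiffSMul 𝓘(ℝ, F) 𝓘(ℝ, E) ∞ K Q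
  free : ∀ (g : K) (q : Q), g • q = q → g = 1
  proper : ProperSMul K Q
  L_invariant : ∀ (g : K) (q₀ q₁ : Q), sys.L (g • q₀, g • q₁) = sys.L (q₀, q₁)
  D_invariant : IsInvariantDistribution K sys.D
  Dd_invariant : IsInvariantSet K sys.Dd

/-- The closed (Lie) subgroup `G` of the symmetry group `M` is a horizontal symmetry subgroup:
`V^M(q) ∩ D(q) = V^G(q)` for all `q`. -/
structure IsHorizontalSymmetryGroup (F' F : Type*) [NormedAddCommGroup F'] [NormedSpace ℝ F']
    [NormedAddCommGroup F] [NormedSpace ℝ F]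
    {M : Type*} [Group M] [TopologicalSpace M] [ChartedSpace F' M] [MulAction M Q]
    (G : Subgroup M) [ChartedSpace F G] (sys : DiscreteSystem E Q) : Prop where
  symmetry : IsSymmetryGroup F' M sys
  closed : IsClosed (G : Set M)
  smooth_incl : ContMDiff 𝓘(ℝ, F) 𝓘(ℝ, F') ∞ (Subtype.val : G → M)
  horizontal : ∀ q : Q, verticalSpace E F' M q ⊓ sys.D q = verticalSpace E F G q

/-- The adjoint action `Ad_g` on the Lie algebra. -/
def Ad (F : Type*) [NormedAddCommGroup F] [NormedSpace ℝ F]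
    {K : Type*} [Group K] [TopologicalSpace K] [ChartedSpace F K] (g : K) :
    GroupLieAlgebra 𝓘(ℝ, F) K →L[ℝ] GroupLieAlgebra 𝓘(ℝ, F) K :=
  mfderiv 𝓘(ℝ, F) 𝓘(ℝ, F) (fun h : K => g * h * g⁻¹) 1

/-- The coadjoint map `Ad*_g(μ) = μ ∘ Ad_g`. -/
def coAd (g : K) (μ : GroupLieAlgebra 𝓘(ℝ, F) K →L[ℝ] ℝ) : GroupLieAlgebra 𝓘(ℝ, F) K →L[ℝ] ℝ :=
  μ.comp (Ad F g)

/-- The discrete momentum map `J_d(q₀, q₁) ξ = -D₁L(q₀, q₁) ξ_Q(q₀)`. -/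
def Jd (F : Type*) [NormedAddCommGroup F] [NormedSpace ℝ F]
    (K : Type*) [Group K] [TopologicalSpace K] [ChartedSpace F K] [MulAction K Q]
    (sys : DiscreteSystem E Q) (q₀ q₁ : Q) : GroupLieAlgebra 𝓘(ℝ, F) K →L[ℝ] ℝ :=
  -((D₁ sys.L q₀ q₁).comp (generator E F K q₀))

/-- `𝒥_μ = J_d⁻¹(μ) ⊆ Q × Q`. -/
def levelSet (sys : DiscreteSystem E Q) (μ : GroupLieAlgebra 𝓘(ℝ, F) K →L[ℝ] ℝ) : Set (Q × Q) :=
  {p | Jd F K sys p.1 p.2 = μ}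

/-- `K` is `μ`-good: `L` is regular and `K`-regular, and for each `q` there is a unique `g` with
`J_d(q, g q) = μ`. -/
structure IsGood (sys : DiscreteSystem E Q) (μ : GroupLieAlgebra 𝓘(ℝ, F) K →L[ℝ] ℝ) : Prop where
  regular : ∀ q₀ q₁ : Q, IsRegularAt E sys.L q₀ q₁
  group_regular : ∀ q₀ q₁ : Q, IsRegularOnAt sys.L (verticalSpace E F K) q₀ q₁
  existsUnique : ∀ q : Q, ∃! g : K, (q, g • q) ∈ levelSet sys μ

/-- A `K`-invariant splitting `TQ = W ⊕ U ⊕ S ⊕ H` with `S = V ∩ D`, `D = S ⊕ H`, `V = S ⊕ U`.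
(For horizontal symmetries `V ⊆ D`, so that necessarily `U = 0` and `S = V`.) -/
structure Splitting (F : Type*) [NormedAddCommGroup F] [NormedSpace ℝ F]
    (K : Type*) [Group K] [TopologicalSpace K] [ChartedSpace F K] [MulAction K Q]
    (sys : DiscreteSystem E Q) where
  W : ∀ q : Q, Submodule ℝ (TangentSpace 𝓘(ℝ, E) q)
  U : ∀ q : Q, Submodule ℝ (TangentSpace 𝓘(ℝ, E) q)
  H : ∀ q : Q, Submodule ℝ (TangentSpace 𝓘(ℝ, E) q)
  subbundle_W : IsSmoothSubbundle W
  subbundle_U : IsSmoothSubbundle U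
  subbundle_H : IsSmoothSubbundle H
  invariant_W : IsInvariantDistribution K W
  invariant_U : IsInvariantDistribution K U
  invariant_H : IsInvariantDistribution K H
  D_eq : ∀ q, (verticalSpace E F K q ⊓ sys.D q) ⊔ H q = sys.D q
  D_disjoint : ∀ q, Disjoint (verticalSpace E F K q ⊓ sys.D q) (H q)
  V_eq : ∀ q, (verticalSpace E F K q ⊓ sys.D q) ⊔ U q = verticalSpace E F K q
  V_disjoint : ∀ q, Disjoint (verticalSpace E F K q ⊓ sys.D q) (U q)
  isCompl_W : ∀ q, IsCompl (W q) (sys.D q ⊔ verticalSpace E F K q)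

/-- Horizontal space `W ⊕ H` of the nonholonomic connection `𝒜` of the splitting. -/
def Splitting.hor {sys : DiscreteSystem E Q} (s : Splitting F K sys) (q : Q) :
    Submodule ℝ (TangentSpace 𝓘(ℝ, E) q) :=
  s.W q ⊔ s.H q

end Symmetry

/-! ### The quotient `Q/K` -/

section Quotient

variable {E : Type*} [NormedAddCommGroup E] [NormedSpace ℝ E]
  {Q : Type*} [TopologicalSpace Q] [ChartedSpace E Q] [IsManifold 𝓘(ℝ, E) ∞ Q]
  {F : Type*} [NormedAddCommGroup F] [NormedSpace ℝ F]
  {K : Type*} [Group K] [TopologicalSpace K] [ChartedSpace F K] [MulAction K Q]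
  {B : Type*} [NormedAddCommGroup B] [NormedSpace ℝ B]
  [ChartedSpace B (MulAction.orbitRel.Quotient K Q)]

/-- The quotient map `π : Q → Q/K`. -/
def proj (K : Type*) [Group K] [MulAction K Q] (q : Q) : MulAction.orbitRel.Quotient K Q :=
  Quotient.mk (MulAction.orbitRel K Q) q

/-- The given smooth structure on `Q/K` makes `π : Q → Q/K` a smooth principal bundle: `π` is
smooth, and over a neighbourhood `O` of each point there are a smooth section `s` and a smooth map
`τ` with `q = τ(q) s(π(q))`, that is, `(x, g) ↦ g s(x)` is a trivialization over `O`. -/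
def IsPrincipalBundle (E F B : Type*) [NormedAddCommGroup E] [NormedSpace ℝ E]
    [NormedAddCommGroup F] [NormedSpace ℝ F] [NormedAddCommGroup B] [NormedSpace ℝ B]
    (K : Type*) [Group K] [TopologicalSpace K] [ChartedSpace F K]
    (Q : Type*) [TopologicalSpace Q] [ChartedSpace E Q] [MulAction K Q]
    [ChartedSpace B (MulAction.orbitRel.Quotient K Q)] : Prop :=
  ContMDiff 𝓘(ℝ, E) 𝓘(ℝ, B) ∞ (proj K : Q → MulAction.orbitRel.Quotient K Q) ∧
  ∀ x₀ : MulAction.orbitRel.Quotient K Q, ∃ O : Set (MulAction.orbitRel.Quotient K Q),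
    IsOpen O ∧ x₀ ∈ O ∧
    ∃ (s : MulAction.orbitRel.Quotient K Q → Q) (τ : Q → K),
      ContMDiffOn 𝓘(ℝ, B) 𝓘(ℝ, E) ∞ s O ∧ (∀ x ∈ O, proj K (s x) = x) ∧
      ContMDiffOn 𝓘(ℝ, E) 𝓘(ℝ, F) ∞ τ (proj K ⁻¹' O) ∧
      ∀ q : Q, proj K q ∈ O → q = τ q • s (proj K q)

/-- `dπ(q) : T_qQ → T_{π(q)}(Q/K)`. -/
def dproj (E B : Type*) [NormedAddCommGroup E] [NormedSpace ℝ E]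
    [NormedAddCommGroup B] [NormedSpace ℝ B] [ChartedSpace E Q]
    (K : Type*) [Group K] [MulAction K Q]
    [ChartedSpace B (MulAction.orbitRel.Quotient K Q)] (q : Q) :
    TangentSpace 𝓘(ℝ, E) q →L[ℝ] TangentSpace 𝓘(ℝ, B) (proj K q) :=
  mfderiv 𝓘(ℝ, E) 𝓘(ℝ, B) (proj K) q

/-- The horizontal lift `T_{π(q)}(Q/K) → T_qQ` of the nonholonomic connection: the inverse of the
isomorphism `dπ(q) : Hor(q) → T_{π(q)}(Q/K)`. -/
def Splitting.lift {sys : DiscreteSystem E Q} (s : Splitting F K sys) (q : Q) :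
    TangentSpace 𝓘(ℝ, B) (proj K q) →L[ℝ] TangentSpace 𝓘(ℝ, E) q :=
  (s.hor q).subtypeL.comp ((dproj E B K q).comp (s.hor q).subtypeL).inverse

/-! ### Discrete connection forms and discrete horizontal lifts

`Hor ⊆ Q × Q` is the horizontal set of an affine discrete connection and `Ω` an open neighbourhood
of its level `Γ`, inside which decompositions are unique. -/

/-- The domain of the discrete connection form: the interior of the set of all `(q₀, q₁)` for which
there is a unique `g` with `(q₀, g⁻¹ q₁) ∈ Hor ∩ Ω`. -/
def connDomain (K : Type*) [Group K] [MulAction K Q] (Hor Ω : Set (Q × Q)) : Set (Q × Q) :=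
  interior {p | ∃! g : K, (p.1, g⁻¹ • p.2) ∈ Hor ∩ Ω}

/-- The discrete connection form `𝒜_d : Q × Q → K` (meaningful on `connDomain`): `𝒜_d(q₀, q₁)` is
the element `g` with `(q₀, g⁻¹ q₁) ∈ Hor ∩ Ω`. -/
def connForm (K : Type*) [Group K] [MulAction K Q] (Hor Ω : Set (Q × Q)) (p : Q × Q) : K :=
  Classical.epsilon fun g : K => (p.1, g⁻¹ • p.2) ∈ Hor ∩ Ω

/-- The relation "`q₁` is a discrete horizontal lift of `r₁` at `q₀`". -/
def IsDiscreteLift (K : Type*) [Group K] [MulAction K Q] (Hor Ω : Set (Q × Q)) (q₀ : Q)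
    (r₁ : MulAction.orbitRel.Quotient K Q) (q₁ : Q) : Prop :=
  (q₀, q₁) ∈ Hor ∩ Ω ∧ proj K q₁ = r₁

/-- The second component of the discrete horizontal lift of `r₁` at `q₀`. -/
def discreteLift (K : Type*) [Group K] [MulAction K Q] (Hor Ω : Set (Q × Q)) (q₀ : Q)
    (r₁ : MulAction.orbitRel.Quotient K Q) : Q :=
  @Classical.epsilon Q ⟨q₀⟩ (IsDiscreteLift K Hor Ω q₀ r₁)

/-- The curve with `q₀` given and `qₖ₊₁` the discrete horizontal lift of `rₖ₊₁` at `qₖ`. -/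
def liftedCurve (K : Type*) [Group K] [MulAction K Q] (Hor Ω : Set (Q × Q)) (q₀ : Q) {N : ℕ}
    (r : Fin (N + 1) → MulAction.orbitRel.Quotient K Q) : Fin (N + 1) → Q :=
  fun k => Fin.induction (motive := fun _ => Q) q₀
    (fun i qi => discreteLift K Hor Ω qi (r i.succ)) k

/-- `Ω` is a `K`-invariant open neighbourhood in `Q × Q` of the level
`Γ = {(q, g q) : (q, g q) ∈ Hor}`. -/
structure IsLevelNeighborhood (K : Type*) [Group K] [MulAction K Q] (Hor Ω : Set (Q × Q)) :
    Prop where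
  isOpen : IsOpen Ω
  invariant : IsInvariantSet K Ω
  level_subset : ∀ (q : Q) (g : K), (q, g • q) ∈ Hor → (q, g • q) ∈ Ω

/-! ### The conjugate associated bundle and the reduced system -/

/-- Orbit relation of the action `g (q, w) = (g q, g w g⁻¹)` on `Q × K`. -/
def conjSetoid (K : Type*) [Group K] (Q : Type*) [MulAction K Q] : Setoid (Q × K) where
  r p p' := ∃ g : K, g • p.1 = p'.1 ∧ g * p.2 * g⁻¹ = p'.2
  iseqv := by
    refine ⟨fun p => ⟨1, by simp⟩, ?_, ?_⟩
    · rintro p p' ⟨g, h₁, h₂⟩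
      exact ⟨g⁻¹, by simp [← h₁], by simp [← h₂, mul_assoc]⟩
    · rintro p p' p'' ⟨g, h₁, h₂⟩ ⟨g', h₁', h₂'⟩
      exact ⟨g' * g, by simp [← h₁', ← h₁, mul_smul], by simp [← h₂', ← h₂, mul_assoc]⟩

/-- The conjugate associated bundle `(Q × K)/K`. -/
abbrev ConjBundle (K : Type*) [Group K] (Q : Type*) [MulAction K Q] : Type _ :=
  Quotient (conjSetoid K Q)

/-- The quotient map `ρ : Q × K → (Q × K)/K`. -/
def rho (q : Q) (w : K) : ConjBundle K Q := Quotient.mk (conjSetoid K Q) (q, w)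

/-- The inclusion `𝒴(r₀, r₁) = (ρ(q₀, e), r₁)` with `π(q₀) = r₀`. -/
def inclusionY (p : MulAction.orbitRel.Quotient K Q × MulAction.orbitRel.Quotient K Q) :
    ConjBundle K Q × MulAction.orbitRel.Quotient K Q :=
  (rho p.1.out 1, p.2)

/-- `F̃₁(q₀, w₀, r₁) = w₀ · (discrete horizontal lift of r₁ at q₀)`. -/
def liftedStep (Hor Ω : Set (Q × Q)) (q₀ : Q) (w₀ : K) (r₁ : MulAction.orbitRel.Quotient K Q) :
    Q :=
  w₀ • discreteLift K Hor Ω q₀ r₁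

/-- `Ľ(q₀, w₀, r₁) = L(q₀, F̃₁(q₀, w₀, r₁))`. -/
def Lcheck (L : Q × Q → ℝ) (Hor Ω : Set (Q × Q)) (q₀ : Q) (w₀ : K)
    (r₁ : MulAction.orbitRel.Quotient K Q) : ℝ :=
  L (q₀, liftedStep Hor Ω q₀ w₀ r₁)

/-- The reduced lagrangian `L̂(ρ(q₀, w₀), r₁) = Ľ(q₀, w₀, r₁)`. -/
def Lhat (L : Q × Q → ℝ) (Hor Ω : Set (Q × Q))
    (z : ConjBundle K Q × MulAction.orbitRel.Quotient K Q) : ℝ :=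
  Lcheck L Hor Ω z.1.out.1 z.1.out.2 z.2

/-- `Υ(q₀, q₁) = (ρ(q₀, 𝒜_d(q₀, q₁)), π(q₁))`. -/
def Upsilon (K : Type*) [Group K] [MulAction K Q] (Hor Ω : Set (Q × Q)) (p : Q × Q) :
    ConjBundle K Q × MulAction.orbitRel.Quotient K Q :=
  (rho p.1 (connForm K Hor Ω p), proj K p.2)

/-- Reduced kinematic constraints `D̂_d`: the image under `Υ` of (the part in the domain of `𝒜_d`
of) `D_d`. -/
def Ddhat (K : Type*) [Group K] [MulAction K Q] (Hor Ω Dd : Set (Q × Q)) :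
    Set (ConjBundle K Q × MulAction.orbitRel.Quotient K Q) :=
  Upsilon K Hor Ω '' (Dd ∩ connDomain K Hor Ω)

/-- The reduced force
`F̂(ρ(q₀, w₀), r₁)(δr₀, δr₁) = D₂Ľ(q₀, w₀, r₁) d𝒜_d(q₀, q₁)(h_{q₀}(δr₀), h_{q₁}(δr₁))`,
with `q₁ = F̃₁(q₀, w₀, r₁)` and `h` the horizontal lift of the nonholonomic connection. -/
def Fhat {sys : DiscreteSystem E Q} (s : Splitting F K sys) (Hor Ω : Set (Q × Q))
    (z : ConjBundle K Q × MulAction.orbitRel.Quotient K Q) : (B × B) →L[ℝ] ℝ :=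
  let q₀ := z.1.out.1
  let w₀ := z.1.out.2
  let q₁ := liftedStep Hor Ω q₀ w₀ z.2
  let h₀ : B →L[ℝ] E := s.lift (B := B) q₀
  let h₁ : B →L[ℝ] E := s.lift (B := B) q₁
  let dA : (E × E) →L[ℝ] F :=
    mfderiv (𝓘(ℝ, E).prod 𝓘(ℝ, E)) 𝓘(ℝ, F) (connForm K Hor Ω) (q₀, q₁)
  let dL : F →L[ℝ] ℝ := mfderiv 𝓘(ℝ, F) 𝓘(ℝ, ℝ) (fun w : K => Lcheck sys.L Hor Ω q₀ w z.2) w₀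
  dL.comp (dA.comp (h₀.prodMap h₁))

/-- The reduced forced system `(Q/K, L̆, D̆, D̆_d, F̆)`: `L̆ = L̂ ∘ 𝒴`, `D̆ = dπ(D)`,
`D̆_d = 𝒴⁻¹(D̂_d)`, `F̆ = 𝒴*F̂`. -/
def reducedSystem (B : Type*) [NormedAddCommGroup B] [NormedSpace ℝ B]
    [ChartedSpace B (MulAction.orbitRel.Quotient K Q)]
    {sys : DiscreteSystem E Q} (s : Splitting F K sys) (Hor Ω : Set (Q × Q)) :
    ForcedData B (MulAction.orbitRel.Quotient K Q) where
  L := Lhat sys.L Hor Ω ∘ inclusionY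
  D r := ((sys.D r.out).map (dproj E B K r.out).toLinearMap : Submodule ℝ B)
  Dd := inclusionY ⁻¹' Ddhat K Hor Ω sys.Dd
  f p := (Fhat (B := B) s Hor Ω (inclusionY p) : (B × B) →L[ℝ] ℝ)

end Quotient

end DiscreteMechanics

end

/-! The proof splits each variation into a horizontal and a vertical part, `δₖ = hₖ + (ξₖ)_Q(qₖ)`,
where `hₖ` is the horizontal lift of `bₖ = dπ(δₖ)`.

Vertical part: invariance gives `dL(ξ_Q, η_Q) = J_d(η) - J_d(ξ)`. Every pair `(qₖ, qₖ₊₁)` has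
momentum `μ`, so the vertical terms are `μ(ξₖ₊₁) - μ(ξₖ)`. They telescope to zero, because freeness
makes `ξ` vanish wherever `δ` does (`tangentDeriv_vertical`).

Horizontal part: near a horizontal pair, `L̆(π(p₀), π(p₁)) = L(p₀, 𝒜_d(p)⁻¹ p₁)`. Since `𝒜_d = e` at
the pair itself, the derivative there is `dL(v, w)` minus `D₂L` applied to the vertical vector
generated by `d𝒜_d(v, w)`. On horizontal lifts the missing term is exactly the reduced force, so
`dL̆ + F̆` on `(b₀, b₁)` is `dL` on `(h₀, h₁)` (`tangentDeriv_Lhat_add_reducedForce`), and the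
reduced equations kill the sum. This needs `𝒜_d` differentiable, which follows from the implicit
function theorem and regularity of `D₂D₁L` on vertical vectors (`mdifferentiableAt_connForm`).

Kinematic constraints: a point of `D̆_d` comes from a pair in `D_d` with `𝒜_d = e`, that is, a
horizontal pair. As `Ad*` fixes `μ`, the level `𝒥_μ` is `G`-invariant, so this pair can be
translated to start at `qₖ`, and its second point is then the discrete lift
(`exists_lift_of_mem_Ddhat`). -/

noncomputable section

namespace DiscreteMechanics

/-! ### Derivatives between the fixed model spaces, and the implicit function theorem. -/

section Calculus

variable {E₁ H₁ E₂ H₂ E₃ H₃ : Type*}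
  [NormedAddCommGroup E₁] [NormedSpace ℝ E₁] [TopologicalSpace H₁] {I₁ : ModelWithCorners ℝ E₁ H₁}
  [NormedAddCommGroup E₂] [NormedSpace ℝ E₂] [TopologicalSpace H₂] {I₂ : ModelWithCorners ℝ E₂ H₂}
  [NormedAddCommGroup E₃] [NormedSpace ℝ E₃] [TopologicalSpace H₃] {I₃ : ModelWithCorners ℝ E₃ H₃}
  {X : Type*} [TopologicalSpace X] [ChartedSpace H₁ X]
  {Y : Type*} [TopologicalSpace Y] [ChartedSpace H₂ Y]
  {Z : Type*} [TopologicalSpace Z] [ChartedSpace H₃ Z]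

variable (I₁ I₂) in
/-- The manifold derivative, as a map between the model vector spaces. -/
def tangentDeriv (f : X → Y) (x : X) : E₁ →L[ℝ] E₂ := mfderiv I₁ I₂ f x

/-- The base point `y` is a separate variable, so that the outer derivative can be taken at a
simplified point, such as `q` in place of `1 • q`. -/
theorem tangentDeriv_comp {g : Y → Z} {f : X → Y} {x : X} {y : Y} (hy : f x = y)
    (hg : MDifferentiableAt I₂ I₃ g y) (hf : MDifferentiableAt I₁ I₂ f x) (v : E₁) :
    tangentDeriv I₁ I₃ (fun x => g (f x)) x v
      = tangentDeriv I₂ I₃ g y (tangentDeriv I₁ I₂ f x v) := by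
  subst hy
  exact congrArg (fun T : E₁ →L[ℝ] E₃ => T v) (mfderiv_comp x hg hf)

theorem tangentDeriv_congr {f g : X → Y} {x : X} (h : f =ᶠ[𝓝 x] g) :
    tangentDeriv I₁ I₂ f x = tangentDeriv I₁ I₂ g x :=
  h.mfderiv_eq

@[simp] theorem tangentDeriv_id (x : X) (v : E₁) :
    tangentDeriv I₁ I₁ (fun x : X => x) x v = v :=
  congrArg (fun T : E₁ →L[ℝ] E₁ => T v) (mfderiv_id (I := I₁) (x := x))

@[simp] theorem tangentDeriv_const (y : Y) (x : X) (v : E₁) :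
    tangentDeriv I₁ I₂ (fun _ : X => y) x v = 0 :=
  congrArg (fun T : E₁ →L[ℝ] E₂ => T v) (mfderiv_const (I := I₁) (I' := I₂) (x := x) (c := y))

theorem tangentDeriv_prodMk {f : X → Y} {g : X → Z} {x : X}
    (hf : MDifferentiableAt I₁ I₂ f x) (hg : MDifferentiableAt I₁ I₃ g x) (v : E₁) :
    tangentDeriv I₁ (I₂.prod I₃) (fun x => (f x, g x)) x v
      = (tangentDeriv I₁ I₂ f x v, tangentDeriv I₁ I₃ g x v) :=
  congrArg (fun T : E₁ →L[ℝ] E₂ × E₃ => T v) (mfderiv_prodMk hf hg)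

theorem tangentDeriv_fst (p : X × Y) (v : E₁ × E₂) :
    tangentDeriv (I₁.prod I₂) I₁ (fun p : X × Y => p.1) p v = v.1 :=
  congrArg (fun T : E₁ × E₂ →L[ℝ] E₁ => T v) (mfderiv_fst (I := I₁) (I' := I₂) (x := p))

theorem tangentDeriv_snd (p : X × Y) (v : E₁ × E₂) :
    tangentDeriv (I₁.prod I₂) I₂ (fun p : X × Y => p.2) p v = v.2 :=
  congrArg (fun T : E₁ × E₂ →L[ℝ] E₂ => T v) (mfderiv_snd (I := I₁) (I' := I₂) (x := p))

theorem tangentDeriv_uncurry {f : X × Y → Z} {x : X} {y : Y}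
    (hf : MDifferentiableAt (I₁.prod I₂) I₃ f (x, y)) (v : E₁) (w : E₂) :
    tangentDeriv (I₁.prod I₂) I₃ f (x, y) (v, w)
      = tangentDeriv I₁ I₃ (fun x => f (x, y)) x v
        + tangentDeriv I₂ I₃ (fun y => f (x, y)) y w :=
  mfderiv_prod_eq_add_apply (v := ((v, w) : E₁ × E₂)) hf

/-- A partial derivative of a smooth function with values in a vector space depends smoothly on
the other variable. -/
theorem contMDiff_tangentDeriv_right [IsManifold I₁ ∞ X] [IsManifold I₂ ∞ Y]
    {f : X × Y → E₃} (hf : ContMDiff (I₁.prod I₂) 𝓘(ℝ, E₃) ∞ f) (y : Y) :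
    ContMDiff I₁ 𝓘(ℝ, E₂ →L[ℝ] E₃) ∞
      (fun x => tangentDeriv I₂ 𝓘(ℝ, E₃) (fun y => f (x, y)) y) := by
  intro x₀
  have : IsManifold I₂ 1 Y := IsManifold.of_le (n := ∞) (by simp)
  have h : ContMDiffAt I₁ 𝓘(ℝ, E₂ →L[ℝ] E₃) ∞ (inTangentCoordinates I₂ 𝓘(ℝ, E₃)
      (fun _ : X => y) (fun x => f (x, y))
      (fun x => tangentDeriv I₂ 𝓘(ℝ, E₃) (fun y => f (x, y)) y) x₀) x₀ :=
    ContMDiffAt.mfderiv (I := I₂) (I' := 𝓘(ℝ, E₃)) (J := I₁) (n := ∞) (m := ∞)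
      (fun x y => f (x, y)) (fun _ : X => y) (hf _) contMDiffAt_const (by simp)
  refine h.congr_of_eventuallyEq (Filter.Eventually.of_forall fun x => ?_)
  refine Eq.trans ?_ (inTangentCoordinates_eq (I := I₂) (I' := 𝓘(ℝ, E₃)) (fun _ : X => y)
    (fun x => f (x, y)) (fun x => tangentDeriv I₂ 𝓘(ℝ, E₃) (fun y => f (x, y)) y)
    (x₀ := x₀) (x := x) (mem_chart_source H₂ y) (Set.mem_univ _)).symm
  ext v
  -- The base point `y` is constant and the target is a vector space, so both coordinate changes are
  -- identities.
  have h₂ := (tangentBundleCore I₂ Y).coordChange_self (achart H₂ y) y (mem_chart_source H₂ y) v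
  have h₃ : ∀ a b w : E₃, (tangentBundleCore 𝓘(ℝ, E₃) E₃).coordChange
      (achart E₃ a) (achart E₃ b) a w = w := by
    intro a b w
    rw [tangentBundleCore_coordChange_model_space]
    rfl
  simp only [ContinuousLinearMap.comp_apply]
  rw [h₂, h₃]

/-- Implicit function theorem on manifolds. -/
theorem exists_implicitFunction [IsManifold I₁ ∞ X] [IsManifold I₂ ∞ Y]
    [I₁.Boundaryless] [I₂.Boundaryless] [CompleteSpace E₁] [FiniteDimensional ℝ E₂]
    [FiniteDimensional ℝ E₃]
    {f : X × Y → E₃} {x₀ : X} {y₀ : Y} (hf : ContMDiffAt (I₁.prod I₂) 𝓘(ℝ, E₃) ∞ f (x₀, y₀))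
    (hinj : Function.Injective (tangentDeriv I₂ 𝓘(ℝ, E₃) (fun y => f (x₀, y)) y₀))
    (hdim : Module.finrank ℝ E₂ = Module.finrank ℝ E₃) :
    ∃ γ : X → Y, γ x₀ = y₀ ∧ MDifferentiableAt I₁ I₂ γ x₀ ∧
      ∀ᶠ x in 𝓝 x₀, f (x, γ x) = f (x₀, y₀) := by
  have : CompleteSpace E₂ := FiniteDimensional.complete ℝ E₂
  have : CompleteSpace E₃ := FiniteDimensional.complete ℝ E₃
  set φ := extChartAt I₁ x₀
  set ψ := extChartAt I₂ y₀
  have hφ : ContMDiffAt 𝓘(ℝ, E₁) I₁ ∞ φ.symm (φ x₀) :=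
    (contMDiffOn_extChartAt_symm x₀).contMDiffAt (extChartAt_target_mem_nhds x₀)
  have hψ : ContMDiffAt 𝓘(ℝ, E₂) I₂ ∞ ψ.symm (ψ y₀) :=
    (contMDiffOn_extChartAt_symm y₀).contMDiffAt (extChartAt_target_mem_nhds y₀)
  have hφ₀ : φ.symm (φ x₀) = x₀ := extChartAt_to_inv x₀
  have hψ₀ : ψ.symm (ψ y₀) = y₀ := extChartAt_to_inv y₀
  -- The function `f` read in charts; its second partial derivative at the base point is the
  -- manifold derivative of `f (x₀, ·)`, invertible by injectivity and equality of dimensions.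
  let θ : E₁ × E₂ → E₃ := fun u => f (φ.symm u.1, ψ.symm u.2)
  have hθ₀ : θ (φ x₀, ψ y₀) = f (x₀, y₀) := by simp only [θ, hφ₀, hψ₀]
  have hθ : ContDiffAt ℝ ∞ θ (φ x₀, ψ y₀) := by
    rw [← contMDiffAt_iff_contDiffAt]
    have h₁ : ContMDiffAt 𝓘(ℝ, E₁ × E₂) I₁ ∞ (fun u : E₁ × E₂ => φ.symm u.1) (φ x₀, ψ y₀) :=
      ContMDiffAt.comp _ (I' := 𝓘(ℝ, E₁)) hφ contDiffAt_fst.contMDiffAt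
    have h₂ : ContMDiffAt 𝓘(ℝ, E₁ × E₂) I₂ ∞ (fun u : E₁ × E₂ => ψ.symm u.2) (φ x₀, ψ y₀) :=
      ContMDiffAt.comp _ (I' := 𝓘(ℝ, E₂)) hψ contDiffAt_snd.contMDiffAt
    refine ContMDiffAt.comp_of_eq (g := f) hf (h₁.prodMk h₂) ?_
    simp only [hφ₀, hψ₀]
  have hpartial : fderiv ℝ θ (φ x₀, ψ y₀) ∘L .inr ℝ E₁ E₂
      = tangentDeriv I₂ 𝓘(ℝ, E₃) (fun y => f (x₀, y)) y₀ := by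
    have h₁ : fderiv ℝ θ (φ x₀, ψ y₀) ∘L .inr ℝ E₁ E₂
        = fderiv ℝ (fun v => θ (φ x₀, v)) (ψ y₀) :=
      (((hθ.differentiableAt (by simp)).hasFDerivAt.comp (ψ y₀)
        (hasFDerivAt_prodMk_right (φ x₀) (ψ y₀))).fderiv).symm
    rw [h₁]
    have hd : MDifferentiableAt I₂ 𝓘(ℝ, E₃) (fun y => f (x₀, y)) y₀ :=
      (ContMDiffAt.comp y₀ hf (contMDiffAt_const.prodMk contMDiffAt_id)).mdifferentiableAt (by simp)
    rw [tangentDeriv, hd.mfderiv, I₂.range_eq_univ, fderivWithin_univ]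
    congr 1
    ext v
    simp only [θ, writtenInExtChartAt, hφ₀, ψ]
    rfl
  have hinv : (fderiv ℝ θ (φ x₀, ψ y₀) ∘L .inr ℝ E₁ E₂).IsInvertible := by
    rw [hpartial]
    set T := tangentDeriv I₂ 𝓘(ℝ, E₃) (fun y => f (x₀, y)) y₀
    exact ⟨(LinearEquiv.ofInjectiveOfFinrankEq T.toLinearMap hinj hdim).toContinuousLinearEquiv,
      by ext; rfl⟩
  let ι := hθ.implicitFunction (by simp) hinv
  have hι₀ : ι (φ x₀) = ψ y₀ := hθ.implicitFunction_apply_self (by simp) hinv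
  have hι : ContDiffAt ℝ ∞ ι (φ x₀) := hθ.contDiffAt_implicitFunction (by simp) hinv
  have hφ' : ContMDiffAt I₁ 𝓘(ℝ, E₁) ∞ φ x₀ := contMDiffAt_extChartAt
  refine ⟨fun x => ψ.symm (ι (φ x)), by simp only [hι₀, hψ₀], ?_, ?_⟩
  · have h₁ : ContMDiffAt I₁ 𝓘(ℝ, E₂) ∞ (fun x => ι (φ x)) x₀ :=
      ContMDiffAt.comp x₀ hι.contMDiffAt hφ'
    exact (ContMDiffAt.comp_of_eq hψ h₁ hι₀).mdifferentiableAt (by simp)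
  · have h₁ := hφ'.continuousAt.eventually
      (hθ.eventually_apply_implicitFunction (by simp) hinv)
    filter_upwards [h₁, extChartAt_source_mem_nhds (I := I₁) x₀] with x hx hxs
    rw [hθ₀] at hx
    rw [← hx]
    simp only [θ]
    rw [φ.left_inv hxs]

end Calculus

/-! ### Derivatives of a smooth group action and of an invariant lagrangian. -/

section Actions

variable {E : Type*} [NormedAddCommGroup E] [NormedSpace ℝ E]
  {Q : Type*} [TopologicalSpace Q] [ChartedSpace E Q]
  {F : Type*} [NormedAddCommGroup F] [NormedSpace ℝ F]
  {K : Type*} [Group K] [TopologicalSpace K] [ChartedSpace F K] [MulAction K Q]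

variable (E F K) in
/-- The infinitesimal generator `ξ ↦ ξ_Q(q)` as a map between the model vector spaces. -/
def orbitDeriv (q : Q) : F →L[ℝ] E := tangentDeriv 𝓘(ℝ, F) 𝓘(ℝ, E) (fun g : K => g • q) 1

variable (E) in
/-- The tangent lift of the action of `g`, as a map between the model vector spaces. -/
def actDeriv (g : K) (q : Q) : E →L[ℝ] E := tangentDeriv 𝓘(ℝ, E) 𝓘(ℝ, E) (fun x : Q => g • x) q

section Smooth

variable [ContMDiffSMul 𝓘(ℝ, F) 𝓘(ℝ, E) ∞ K Q]

variable (E F) in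
theorem mdifferentiableAt_smul_prod (p : K × Q) :
    MDifferentiableAt (𝓘(ℝ, F).prod 𝓘(ℝ, E)) 𝓘(ℝ, E) (fun p : K × Q => p.1 • p.2) p :=
  (contMDiff_smul (I := 𝓘(ℝ, F)) (I' := 𝓘(ℝ, E)) (n := ∞)).mdifferentiableAt (by simp)

variable (E F) in
theorem contMDiff_smul_right (q : Q) : ContMDiff 𝓘(ℝ, F) 𝓘(ℝ, E) ∞ (fun g : K => g • q) :=
  (contMDiff_smul (I := 𝓘(ℝ, F)) (I' := 𝓘(ℝ, E)) (n := ∞)).comp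
    (contMDiff_id.prodMk contMDiff_const)

variable (E F) in
include F in
theorem contMDiff_smul_left (g : K) : ContMDiff 𝓘(ℝ, E) 𝓘(ℝ, E) ∞ (fun q : Q => g • q) :=
  (contMDiff_smul (I := 𝓘(ℝ, F)) (I' := 𝓘(ℝ, E)) (n := ∞)).comp
    (contMDiff_const.prodMk contMDiff_id)

variable (E F) in
theorem mdifferentiableAt_smul_right (q : Q) (g : K) :
    MDifferentiableAt 𝓘(ℝ, F) 𝓘(ℝ, E) (fun g : K => g • q) g :=
  (contMDiff_smul_right E F q).mdifferentiableAt (by simp)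

variable (E F) in
include F in
theorem mdifferentiableAt_smul_left (g : K) (q : Q) :
    MDifferentiableAt 𝓘(ℝ, E) 𝓘(ℝ, E) (fun q : Q => g • q) q :=
  (contMDiff_smul_left E F g).mdifferentiableAt (by simp)

theorem tangentDeriv_smul {E₁ H₁ X : Type*} [NormedAddCommGroup E₁] [NormedSpace ℝ E₁]
    [TopologicalSpace H₁] {I₁ : ModelWithCorners ℝ E₁ H₁} [TopologicalSpace X] [ChartedSpace H₁ X]
    {γ : X → K} {c : X → Q} {x : X} (hγ : MDifferentiableAt I₁ 𝓘(ℝ, F) γ x)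
    (hc : MDifferentiableAt I₁ 𝓘(ℝ, E) c x) (v : E₁) :
    tangentDeriv I₁ 𝓘(ℝ, E) (fun x => γ x • c x) x v
      = tangentDeriv 𝓘(ℝ, F) 𝓘(ℝ, E) (fun g : K => g • c x) (γ x) (tangentDeriv I₁ 𝓘(ℝ, F) γ x v)
        + actDeriv E (γ x) (c x) (tangentDeriv I₁ 𝓘(ℝ, E) c x v) := by
  rw [tangentDeriv_comp (g := fun p : K × Q => p.1 • p.2) (f := fun x => (γ x, c x)) rfl
    (mdifferentiableAt_smul_prod E F _) (hγ.prodMk hc), tangentDeriv_prodMk hγ hc,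
    tangentDeriv_uncurry (mdifferentiableAt_smul_prod E F _)]
  rfl

omit [TopologicalSpace K] in
@[simp] theorem actDeriv_one (q : Q) (v : E) : actDeriv E (1 : K) q v = v := by
  simp [actDeriv]

variable (F) in
/-- The adjoint action as a map between the model vector spaces. -/
def adjointDeriv (g : K) : F →L[ℝ] F :=
  tangentDeriv 𝓘(ℝ, F) 𝓘(ℝ, F) (fun h : K => g * h * g⁻¹) 1

/-- Restricting the derivative of the action map to the orbit of `q`, right translated. -/
theorem tangentDeriv_smul_right_eq [LieGroup 𝓘(ℝ, F) ∞ K] (g : K) (q : Q) (v : F) :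
    tangentDeriv 𝓘(ℝ, F) 𝓘(ℝ, E) (fun h : K => h • q) g v
      = orbitDeriv E F K (g • q) (tangentDeriv 𝓘(ℝ, F) 𝓘(ℝ, F) (fun h : K => h * g⁻¹) g v) := by
  have h₁ := tangentDeriv_comp (g := fun h : K => h • (g • q)) (f := fun h : K => h * g⁻¹)
    (x := g) (mul_inv_cancel g) (mdifferentiableAt_smul_right E F _ _)
    ((contMDiff_mul_right (I := 𝓘(ℝ, F)) (n := ∞)).mdifferentiableAt (by simp)) v
  simp only [smul_smul, inv_mul_cancel_right] at h₁
  simp only [orbitDeriv, smul_smul]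
  exact h₁

/-- Both sides are derivatives at `1` of the same map `h ↦ (g h) q = (g h g⁻¹) (g q)`. -/
theorem actDeriv_orbitDeriv [LieGroup 𝓘(ℝ, F) ∞ K] (g : K) (q : Q) (ξ : F) :
    actDeriv E g q (orbitDeriv E F K q ξ) = orbitDeriv E F K (g • q) (adjointDeriv F g ξ) := by
  have h₁ := tangentDeriv_comp (g := fun x : Q => g • x) (f := fun h : K => h • q) (x := 1)
    (one_smul K q) (mdifferentiableAt_smul_left E F g _) (mdifferentiableAt_smul_right E F _ _) ξ
  have h₂ := tangentDeriv_comp (g := fun h : K => h • (g • q)) (f := fun h : K => g * h * g⁻¹)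
    (x := 1) (y := 1) (by simp) (mdifferentiableAt_smul_right E F _ _)
    (((contMDiff_mul_right (I := 𝓘(ℝ, F)) (n := ∞)).comp
      (contMDiff_mul_left (I := 𝓘(ℝ, F)) (n := ∞))).mdifferentiableAt (by simp)) ξ
  simp only [smul_smul, inv_mul_cancel_right] at h₁ h₂
  simp only [orbitDeriv, smul_smul]
  exact h₁.symm.trans h₂

section Lagrangian

variable {L : Q × Q → ℝ} (hL : ContMDiff (𝓘(ℝ, E).prod 𝓘(ℝ, E)) 𝓘(ℝ, ℝ) ∞ L)
  (hinv : ∀ (g : K) (q₀ q₁ : Q), L (g • q₀, g • q₁) = L (q₀, q₁))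

variable (F) in
include F hL hinv in
theorem tangentDeriv_actDeriv (g : K) (q₀ q₁ : Q) (v w : E) :
    tangentDeriv (𝓘(ℝ, E).prod 𝓘(ℝ, E)) 𝓘(ℝ, ℝ) L (g • q₀, g • q₁)
      (actDeriv E g q₀ v, actDeriv E g q₁ w)
    = tangentDeriv (𝓘(ℝ, E).prod 𝓘(ℝ, E)) 𝓘(ℝ, ℝ) L (q₀, q₁) (v, w) := by
  have h₀ : MDifferentiableAt (𝓘(ℝ, E).prod 𝓘(ℝ, E)) 𝓘(ℝ, E) (fun p : Q × Q => g • p.1) (q₀, q₁) :=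
    (mdifferentiableAt_smul_left E F g _).comp _ mdifferentiableAt_fst
  have h₁ : MDifferentiableAt (𝓘(ℝ, E).prod 𝓘(ℝ, E)) 𝓘(ℝ, E) (fun p : Q × Q => g • p.2) (q₀, q₁) :=
    (mdifferentiableAt_smul_left E F g _).comp _ mdifferentiableAt_snd
  have h := tangentDeriv_comp (g := L) (f := fun p : Q × Q => (g • p.1, g • p.2)) (x := (q₀, q₁))
    rfl (hL.mdifferentiableAt (by simp)) (h₀.prodMk h₁) (v, w)
  rw [tangentDeriv_prodMk h₀ h₁,
    tangentDeriv_comp (g := fun x : Q => g • x) (f := fun p : Q × Q => p.1) rfl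
      (mdifferentiableAt_smul_left E F g _) mdifferentiableAt_fst,
    tangentDeriv_comp (g := fun x : Q => g • x) (f := fun p : Q × Q => p.2) rfl
      (mdifferentiableAt_smul_left E F g _) mdifferentiableAt_snd,
    tangentDeriv_fst, tangentDeriv_snd] at h
  simp only [hinv] at h
  exact h.symm

-- The function `g ↦ L (g q₀, g q₁)` is constant. This infinitesimal invariance lets `D₂L` on
-- vertical vectors be expressed by the momentum.
include hL hinv in
theorem tangentDeriv_orbitDeriv (q₀ q₁ : Q) (ξ : F) :
    tangentDeriv (𝓘(ℝ, E).prod 𝓘(ℝ, E)) 𝓘(ℝ, ℝ) L (q₀, q₁)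
      (orbitDeriv E F K q₀ ξ, orbitDeriv E F K q₁ ξ) = 0 := by
  have h := tangentDeriv_comp (g := L) (f := fun g : K => (g • q₀, g • q₁)) (x := 1)
    (y := (q₀, q₁)) (by simp) (hL.mdifferentiableAt (by simp))
    ((mdifferentiableAt_smul_right E F _ _).prodMk (mdifferentiableAt_smul_right E F _ _)) ξ
  rw [tangentDeriv_prodMk (mdifferentiableAt_smul_right E F _ _)
    (mdifferentiableAt_smul_right E F _ _)] at h
  simp only [hinv, tangentDeriv_const] at h
  exact h.symm

end Lagrangian

end Smooth

end Actions

/-! ### Smoothness and equivariance of the discrete momentum map. -/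

section Momentum

variable {E : Type*} [NormedAddCommGroup E] [NormedSpace ℝ E]
  {Q : Type*} [TopologicalSpace Q] [ChartedSpace E Q] [IsManifold 𝓘(ℝ, E) ∞ Q]
  {F : Type*} [NormedAddCommGroup F] [NormedSpace ℝ F]
  {K : Type*} [Group K] [TopologicalSpace K] [ChartedSpace F K] [MulAction K Q]
  [LieGroup 𝓘(ℝ, F) ∞ K] [ContMDiffSMul 𝓘(ℝ, F) 𝓘(ℝ, E) ∞ K Q]

variable (F K) in
/-- The discrete momentum map with values in the dual of the model space of the group. -/
def momentum (sys : DiscreteSystem E Q) (p : Q × Q) : F →L[ℝ] ℝ := Jd F K sys p.1 p.2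

omit [LieGroup 𝓘(ℝ, F) ∞ K] [ContMDiffSMul 𝓘(ℝ, F) 𝓘(ℝ, E) ∞ K Q] in
theorem momentum_apply (sys : DiscreteSystem E Q) (q₀ q₁ : Q) (ξ : F) :
    momentum F K sys (q₀, q₁) ξ
      = -tangentDeriv (𝓘(ℝ, E).prod 𝓘(ℝ, E)) 𝓘(ℝ, ℝ) sys.L (q₀, q₁) (orbitDeriv E F K q₀ ξ, 0) := by
  rw [tangentDeriv_uncurry (sys.smooth_L.mdifferentiableAt (by simp)), map_zero, add_zero]
  rfl

-- Differentiating on the group at the fixed point `1`, instead of on `Q` at a moving point, makes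
-- `J_d` a partial derivative to which `contMDiff_tangentDeriv_right` applies.
omit [LieGroup 𝓘(ℝ, F) ∞ K] in
theorem momentum_eq_neg_tangentDeriv (sys : DiscreteSystem E Q) (p : Q × Q) :
    momentum F K sys p
      = -tangentDeriv 𝓘(ℝ, F) 𝓘(ℝ, ℝ) (fun g : K => sys.L (g • p.1, p.2)) 1 := by
  ext ξ
  have hd : MDifferentiableAt 𝓘(ℝ, E) 𝓘(ℝ, ℝ) (fun q : Q => sys.L (q, p.2)) p.1 :=
    (sys.smooth_L.comp (contMDiff_id.prodMk contMDiff_const)).mdifferentiableAt (by simp)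
  have h := tangentDeriv_comp (g := fun q : Q => sys.L (q, p.2)) (f := fun g : K => g • p.1)
    (x := 1) (one_smul K p.1) hd (mdifferentiableAt_smul_right E F _ _) ξ
  rw [neg_apply, h]
  rfl

theorem contMDiff_momentum (sys : DiscreteSystem E Q) :
    ContMDiff (𝓘(ℝ, E).prod 𝓘(ℝ, E)) 𝓘(ℝ, F →L[ℝ] ℝ) ∞ (momentum F K sys) := by
  have h : ContMDiff ((𝓘(ℝ, E).prod 𝓘(ℝ, E)).prod 𝓘(ℝ, F)) 𝓘(ℝ, ℝ) ∞
      (fun x : (Q × Q) × K => sys.L (x.2 • x.1.1, x.1.2)) := by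
    refine sys.smooth_L.comp (ContMDiff.prodMk ?_ (contMDiff_snd.comp contMDiff_fst))
    exact (contMDiff_smul (I := 𝓘(ℝ, F)) (I' := 𝓘(ℝ, E)) (n := ∞)).comp
      (contMDiff_snd.prodMk (contMDiff_fst.comp contMDiff_fst))
  have : IsManifold 𝓘(ℝ, F) ∞ K := inferInstance
  have h' := (contMDiff_tangentDeriv_right h 1).neg
  exact h'.congr fun p => momentum_eq_neg_tangentDeriv sys p

/-- The tangent action of `g` sends `ξ_Q(q₀)` to `(Ad_g ξ)_Q(g q₀)` and preserves `dL`. -/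
theorem momentum_smul (sys : DiscreteSystem E Q)
    (hinv : ∀ (g : K) (q₀ q₁ : Q), sys.L (g • q₀, g • q₁) = sys.L (q₀, q₁))
    (g : K) (q₀ q₁ : Q) (ξ : F) :
    momentum F K sys (g • q₀, g • q₁) (adjointDeriv F g ξ) = momentum F K sys (q₀, q₁) ξ := by
  rw [momentum_apply, momentum_apply, ← actDeriv_orbitDeriv,
    ← tangentDeriv_actDeriv F sys.smooth_L hinv g q₀ q₁, map_zero]

theorem smul_mem_levelSet {sys : DiscreteSystem E Q} {μ : GroupLieAlgebra 𝓘(ℝ, F) K →L[ℝ] ℝ}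
    (hinv : ∀ (g : K) (q₀ q₁ : Q), sys.L (g • q₀, g • q₁) = sys.L (q₀, q₁))
    (hAd : ∀ g : K, coAd g μ = μ) (g : K) {q₀ q₁ : Q} (h : (q₀, q₁) ∈ levelSet sys μ) :
    (g • q₀, g • q₁) ∈ levelSet sys μ := by
  have h : Jd F K sys q₀ q₁ = μ := h
  change Jd F K sys (g • q₀) (g • q₁) = μ
  rw [← hAd g⁻¹, ← h]
  refine ContinuousLinearMap.ext fun ξ : F => ?_
  have h₁ := momentum_smul sys hinv g⁻¹ (g • q₀) (g • q₁) ξ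
  simp only [inv_smul_smul] at h₁
  exact h₁.symm

/-- The derivative of the momentum map along a group orbit in the second variable. -/
theorem tangentDeriv_momentum_smul (sys : DiscreteSystem E Q) (q₀ q₁ : Q) (ξ η : F) :
    tangentDeriv 𝓘(ℝ, F) 𝓘(ℝ, F →L[ℝ] ℝ) (fun g : K => momentum F K sys (q₀, g • q₁)) 1 ξ η
      = -D₂D₁ sys.L q₀ q₁ (orbitDeriv E F K q₀ η) (orbitDeriv E F K q₁ ξ) := by
  have hJ : MDifferentiableAt 𝓘(ℝ, E) 𝓘(ℝ, F →L[ℝ] ℝ) (fun q => momentum F K sys (q₀, q)) q₁ :=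
    ((contMDiff_momentum sys).comp (contMDiff_const.prodMk contMDiff_id)).mdifferentiableAt
      (by simp)
  rw [tangentDeriv_comp (g := fun q => momentum F K sys (q₀, q)) (f := fun g : K => g • q₁)
    (one_smul K q₁) hJ (mdifferentiableAt_smul_right E F _ _)]
  -- Evaluation at `η` is linear, so it commutes with the derivative and reduces the claim to a
  -- scalar function.
  let ev : (F →L[ℝ] ℝ) →L[ℝ] ℝ := ContinuousLinearMap.apply ℝ ℝ η
  have hev : MDifferentiableAt 𝓘(ℝ, F →L[ℝ] ℝ) 𝓘(ℝ, ℝ) ev (momentum F K sys (q₀, q₁)) :=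
    ev.differentiableAt.mdifferentiableAt
  have h := tangentDeriv_comp (g := ev) (f := fun q => momentum F K sys (q₀, q)) (x := q₁) rfl
    hev hJ (orbitDeriv E F K q₁ ξ)
  have hev' : ∀ T : F →L[ℝ] ℝ, tangentDeriv 𝓘(ℝ, F →L[ℝ] ℝ) 𝓘(ℝ, ℝ) ev
      (momentum F K sys (q₀, q₁)) T = T η := by
    intro T
    have : tangentDeriv 𝓘(ℝ, F →L[ℝ] ℝ) 𝓘(ℝ, ℝ) ev (momentum F K sys (q₀, q₁)) = ev := by
      rw [tangentDeriv, mfderiv_eq_fderiv, ev.fderiv]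
    rw [this]
    rfl
  rw [hev'] at h
  refine h.symm.trans ?_
  have e : (fun q => ev (momentum F K sys (q₀, q)))
      = fun q => -(D₁ sys.L q₀ q (orbitDeriv E F K q₀ η)) := rfl
  rw [e]
  exact congrArg (fun T : E →L[ℝ] ℝ => T (orbitDeriv E F K q₁ ξ)) (mfderiv_neg (I := 𝓘(ℝ, E))
    (f := fun q => (D₁ sys.L q₀ q (orbitDeriv E F K q₀ η) : ℝ)) (x := q₁))

end Momentum

/-! ### The principal bundle: vertical vectors form the kernel of `dπ`. -/

section Bundle

variable {E : Type*} [NormedAddCommGroup E] [NormedSpace ℝ E]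
  {Q : Type*} [TopologicalSpace Q] [ChartedSpace E Q]
  {F : Type*} [NormedAddCommGroup F] [NormedSpace ℝ F]
  {K : Type*} [Group K] [TopologicalSpace K] [ChartedSpace F K] [MulAction K Q]
  {B : Type*} [NormedAddCommGroup B] [NormedSpace ℝ B]
  [ChartedSpace B (MulAction.orbitRel.Quotient K Q)]

section Orbits

omit [TopologicalSpace Q] [TopologicalSpace K]

theorem proj_eq_proj_iff {q q' : Q} : proj K q = proj K q' ↔ ∃ g : K, g • q' = q :=
  Quotient.eq (r := MulAction.orbitRel K Q)

@[simp] theorem proj_smul (g : K) (q : Q) : proj K (g • q) = proj K q :=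
  proj_eq_proj_iff.2 ⟨g, rfl⟩

@[simp] theorem proj_out (r : MulAction.orbitRel.Quotient K Q) : proj K r.out = r :=
  Quotient.out_eq r

end Orbits

variable (E K B) in
/-- `dπ(q)` as a map between the model vector spaces. -/
def projDeriv (q : Q) : E →L[ℝ] B := tangentDeriv 𝓘(ℝ, E) 𝓘(ℝ, B) (proj K : Q → _) q

namespace IsPrincipalBundle

variable (hπ : IsPrincipalBundle E F B K Q)

include hπ

theorem mdifferentiableAt_proj (q : Q) :
    MDifferentiableAt 𝓘(ℝ, E) 𝓘(ℝ, B) (proj K : Q → MulAction.orbitRel.Quotient K Q) q :=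
  hπ.1.mdifferentiableAt (by simp)

variable [ContMDiffSMul 𝓘(ℝ, F) 𝓘(ℝ, E) ∞ K Q]

theorem projDeriv_orbitDeriv (q : Q) (ξ : F) :
    projDeriv E K B q (orbitDeriv E F K q ξ) = 0 := by
  have h := tangentDeriv_comp (g := (proj K : Q → _)) (f := fun g : K => g • q) (x := 1)
    (one_smul K q) (hπ.mdifferentiableAt_proj q) (mdifferentiableAt_smul_right E F _ _) ξ
  simp only [proj_smul, tangentDeriv_const] at h
  exact h.symm

theorem projDeriv_actDeriv (g : K) (q : Q) (v : E) :
    projDeriv E K B (g • q) (actDeriv E g q v) = projDeriv E K B q v := by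
  have h := tangentDeriv_comp (g := (proj K : Q → _)) (f := fun x : Q => g • x) (x := q)
    rfl (hπ.mdifferentiableAt_proj _) (mdifferentiableAt_smul_left E F _ _) v
  simp only [proj_smul] at h
  exact h.symm

/-- Through each point there is a local section of the bundle. -/
theorem exists_section (q : Q) : ∃ σ : MulAction.orbitRel.Quotient K Q → Q,
    MDifferentiableAt 𝓘(ℝ, B) 𝓘(ℝ, E) σ (proj K q) ∧ σ (proj K q) = q ∧
      ∀ᶠ x in 𝓝 (proj K q), proj K (σ x) = x := by
  obtain ⟨O, hO, hx, s, τ, hs, hps, -, hτ⟩ := hπ.2 (proj K q)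
  -- The section of the trivialization is translated by `τ q` to pass through `q`.
  refine ⟨fun x => τ q • s x, ?_, (hτ q hx).symm, ?_⟩
  · exact (mdifferentiableAt_smul_left E F (τ q) _).comp (proj K q)
      ((hs.contMDiffAt (hO.mem_nhds hx)).mdifferentiableAt (by simp))
  · filter_upwards [hO.mem_nhds hx] with x hx
    rw [proj_smul, hps x hx]

theorem projDeriv_surjective (q : Q) : Function.Surjective (projDeriv E K B q) := by
  obtain ⟨σ, hσ, hσq, hev⟩ := hπ.exists_section q
  intro b
  refine ⟨tangentDeriv 𝓘(ℝ, B) 𝓘(ℝ, E) σ (proj K q) b, ?_⟩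
  have h := tangentDeriv_comp (g := (proj K : Q → _)) (f := σ) hσq (hπ.mdifferentiableAt_proj q)
    hσ b
  rw [tangentDeriv_congr (g := fun x => x) hev, tangentDeriv_id] at h
  exact h.symm

variable [LieGroup 𝓘(ℝ, F) ∞ K]

/-- Freeness gives `τ(g q) τ(q)⁻¹ = g`, so the orbit map has a left inverse differentiable at `q`.
-/
theorem orbitDeriv_injective (hfree : ∀ (g : K) (q : Q), g • q = q → g = 1) (q : Q) :
    Function.Injective (orbitDeriv E F K q) := by
  obtain ⟨O, hO, hx, s, τ, hs, hps, hτs, hτ⟩ := hπ.2 (proj K q)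
  have hτd : MDifferentiableAt 𝓘(ℝ, E) 𝓘(ℝ, F) τ q :=
    (hτs.contMDiffAt ((hO.preimage hπ.1.continuous).mem_nhds hx)).mdifferentiableAt (by simp)
  have hequiv : ∀ g : K, τ (g • q) * (τ q)⁻¹ = g := by
    intro g
    have h₁ := hτ q hx
    have h₂ := hτ (g • q) (by rwa [proj_smul])
    rw [proj_smul] at h₂
    have h₃ : s (proj K q) = (τ q)⁻¹ • q := by rw [eq_inv_smul_iff, ← h₁]
    rw [h₃, smul_smul] at h₂
    refine (inv_mul_eq_one.1 (hfree (g⁻¹ * (τ (g • q) * (τ q)⁻¹)) q ?_)).symm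
    rw [mul_smul, ← h₂, inv_smul_smul]
  have hR : MDifferentiableAt 𝓘(ℝ, F) 𝓘(ℝ, F) (fun h : K => h * (τ q)⁻¹) (τ q) :=
    (contMDiff_mul_right (I := 𝓘(ℝ, F)) (n := ∞)).mdifferentiableAt (by simp)
  refine Function.LeftInverse.injective
    (g := fun v => tangentDeriv 𝓘(ℝ, F) 𝓘(ℝ, F) (fun h : K => h * (τ q)⁻¹) (τ q)
      (tangentDeriv 𝓘(ℝ, E) 𝓘(ℝ, F) τ q v)) fun ξ => ?_
  have h₁ := tangentDeriv_comp (g := τ) (f := fun g : K => g • q) (one_smul K q) hτd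
    (mdifferentiableAt_smul_right E F _ _) ξ
  have h₂ := tangentDeriv_comp (g := fun h : K => h * (τ q)⁻¹) (f := fun g : K => τ (g • q))
    (x := 1) (by rw [one_smul]) hR (MDifferentiableAt.comp_of_eq (1 : K) hτd
      (mdifferentiableAt_smul_right E F _ _) (one_smul K q)) ξ
  simp only [hequiv, tangentDeriv_id] at h₂
  rw [h₁] at h₂
  exact h₂.symm

/-- Differentiate `x = τ(x) s(π(x))` along `v`: when `dπ(v) = 0` the section contributes nothing and
only an orbit direction remains. -/
theorem exists_orbitDeriv_eq {q : Q} {v : E} (hv : projDeriv E K B q v = 0) :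
    ∃ ξ : F, orbitDeriv E F K q ξ = v := by
  obtain ⟨O, hO, hx, s, τ, hs, hps, hτs, hτ⟩ := hπ.2 (proj K q)
  have hnhds := (hO.preimage hπ.1.continuous).mem_nhds hx
  have hτd : MDifferentiableAt 𝓘(ℝ, E) 𝓘(ℝ, F) τ q :=
    (hτs.contMDiffAt hnhds).mdifferentiableAt (by simp)
  have hsd : MDifferentiableAt 𝓘(ℝ, B) 𝓘(ℝ, E) s (proj K q) :=
    (hs.contMDiffAt (hO.mem_nhds hx)).mdifferentiableAt (by simp)
  have hev : (fun x : Q => x) =ᶠ[𝓝 q] fun x => τ x • s (proj K x) := by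
    filter_upwards [hnhds] with x hx using hτ x hx
  have h := congrArg (fun T : E →L[ℝ] E => T v) (tangentDeriv_congr (I₁ := 𝓘(ℝ, E))
    (I₂ := 𝓘(ℝ, E)) hev)
  simp only [tangentDeriv_id] at h
  rw [tangentDeriv_smul (c := fun x => s (proj K x)) hτd
    (hsd.comp q (hπ.mdifferentiableAt_proj q)),
    tangentDeriv_comp rfl hsd (hπ.mdifferentiableAt_proj q)] at h
  have hv' : tangentDeriv 𝓘(ℝ, E) 𝓘(ℝ, B) (proj K : Q → _) q v = 0 := hv
  rw [hv', map_zero, map_zero, add_zero, tangentDeriv_smul_right_eq, ← hτ q hx] at h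
  exact ⟨_, h.symm⟩

end IsPrincipalBundle

end Bundle

/-! ### The horizontal lift of the connection with horizontal space `W ⊕ H`. -/

section HorizontalLift

variable {E : Type*} [NormedAddCommGroup E] [NormedSpace ℝ E] [FiniteDimensional ℝ E]
  {Q : Type*} [TopologicalSpace Q] [ChartedSpace E Q] [IsManifold 𝓘(ℝ, E) ∞ Q]
  {F : Type*} [NormedAddCommGroup F] [NormedSpace ℝ F]
  {K : Type*} [Group K] [TopologicalSpace K] [ChartedSpace F K] [MulAction K Q]
  [LieGroup 𝓘(ℝ, F) ∞ K] [ContMDiffSMul 𝓘(ℝ, F) 𝓘(ℝ, E) ∞ K Q]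
  {B : Type*} [NormedAddCommGroup B] [NormedSpace ℝ B]
  [ChartedSpace B (MulAction.orbitRel.Quotient K Q)]
  {sys : DiscreteSystem E Q} (s : Splitting F K sys)

/-- The horizontal space of the splitting as a subspace of the model vector space. -/
def Splitting.horizontal (q : Q) : Submodule ℝ E := s.hor q

/-- The horizontal lift of the splitting as a map between the model vector spaces. -/
def Splitting.liftDeriv (B : Type*) [NormedAddCommGroup B] [NormedSpace ℝ B]
    [ChartedSpace B (MulAction.orbitRel.Quotient K Q)] (q : Q) : B →L[ℝ] E := s.lift (B := B) q

omit [FiniteDimensional ℝ E] [LieGroup 𝓘(ℝ, F) ∞ K] [ContMDiffSMul 𝓘(ℝ, F) 𝓘(ℝ, E) ∞ K Q] in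
theorem Splitting.isCompl_horizontal (hV : ∀ q, verticalSpace E F K q ≤ sys.D q) (q : Q) :
    IsCompl (verticalSpace E F K q) (s.hor q) := by
  have h₁ := s.D_eq q
  have h₂ := s.D_disjoint q
  have h₃ := s.isCompl_W q
  rw [inf_eq_left.2 (hV q)] at h₁ h₂
  rw [sup_eq_left.2 (hV q), ← h₁] at h₃
  refine ⟨?_, ?_⟩
  · have h := h₂.disjoint_sup_right_of_disjoint_sup_left (c := s.W q) h₃.disjoint.symm
    rwa [sup_comm] at h
  · rw [codisjoint_iff, Splitting.hor, sup_left_comm]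
    exact h₃.sup_eq_top

omit [FiniteDimensional ℝ E] [LieGroup 𝓘(ℝ, F) ∞ K] [ContMDiffSMul 𝓘(ℝ, F) 𝓘(ℝ, E) ∞ K Q] in
theorem Splitting.actDeriv_mem_horizontal (g : K) {q : Q} {v : E} (hv : v ∈ s.horizontal q) :
    actDeriv E g q v ∈ s.horizontal (g • q) := by
  obtain ⟨w, hw, h, hh, rfl⟩ := (Submodule.mem_sup (R := ℝ) (M := TangentSpace 𝓘(ℝ, E) q)).1 hv
  exact (Submodule.mem_sup (R := ℝ) (M := TangentSpace 𝓘(ℝ, E) (g • q))).2 ⟨actDeriv E g q w, s.invariant_W g q w hw, actDeriv E g q h,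
    s.invariant_H g q h hh, (map_add (actDeriv E g q) w h).symm⟩

variable (hπ : IsPrincipalBundle E F B K Q) (hV : ∀ q, verticalSpace E F K q ≤ sys.D q)
include hπ hV

omit [FiniteDimensional ℝ E] in
theorem Splitting.eq_of_projDeriv_eq {q : Q} {v w : E} (hv : v ∈ s.horizontal q)
    (hw : w ∈ s.horizontal q) (h : projDeriv E K B q v = projDeriv E K B q w) : v = w := by
  obtain ⟨ξ, hξ⟩ := hπ.exists_orbitDeriv_eq (q := q) (v := v - w) (by rw [map_sub, h, sub_self])
  refine sub_eq_zero.1 (Submodule.disjoint_def.1 (s.isCompl_horizontal hV q).disjoint _ ?_ ?_)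
  · exact ⟨ξ, hξ⟩
  · exact (s.horizontal q).sub_mem hv hw

omit [FiniteDimensional ℝ E] [LieGroup 𝓘(ℝ, F) ∞ K] in
theorem Splitting.exists_horizontal_projDeriv_eq (q : Q) (b : B) :
    ∃ v ∈ s.horizontal q, projDeriv E K B q v = b := by
  obtain ⟨u, rfl⟩ := hπ.projDeriv_surjective q b
  have hc : IsCompl (LinearMap.range (orbitDeriv E F K q).toLinearMap) (s.horizontal q) :=
    s.isCompl_horizontal hV q
  have hu : u ∈ LinearMap.range (orbitDeriv E F K q).toLinearMap ⊔ s.horizontal q := by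
    rw [hc.sup_eq_top]
    exact Submodule.mem_top
  obtain ⟨-, ⟨ξ, rfl⟩, w, hw, rfl⟩ := Submodule.mem_sup.1 hu
  refine ⟨w, hw, ?_⟩
  rw [map_add]
  exact (by rw [hπ.projDeriv_orbitDeriv, zero_add] :
    _ = projDeriv E K B q (orbitDeriv E F K q ξ) + projDeriv E K B q w)

/-- The lift is defined through `ContinuousLinearMap.inverse`, which is `0` on non-invertible maps;
hence the need to show that `dπ` is bijective on the horizontal space. -/
theorem Splitting.liftDeriv_spec (q : Q) (b : B) :
    s.liftDeriv B q b ∈ s.horizontal q ∧ projDeriv E K B q (s.liftDeriv B q b) = b := by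
  let T : s.horizontal q →L[ℝ] B := (projDeriv E K B q).comp (s.horizontal q).subtypeL
  have hinj : Function.Injective T := fun v w h =>
    Subtype.ext (s.eq_of_projDeriv_eq hπ hV v.2 w.2 h)
  have hsurj : Function.Surjective T := fun b => by
    obtain ⟨v, hv, h⟩ := s.exists_horizontal_projDeriv_eq hπ hV q b
    exact ⟨⟨v, hv⟩, h⟩
  let e : s.horizontal q ≃L[ℝ] B :=
    (LinearEquiv.ofBijective T.toLinearMap ⟨hinj, hsurj⟩).toContinuousLinearEquiv
  have he : (e : s.horizontal q →L[ℝ] B) = T := by ext; rfl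
  have hl : s.liftDeriv B q b = (s.horizontal q).subtypeL (T.inverse b) := rfl
  rw [hl, ← he, ContinuousLinearMap.inverse_equiv]
  exact ⟨(e.symm b).2, e.apply_symm_apply b⟩

theorem Splitting.actDeriv_liftDeriv (g : K) (q : Q) (b : B) :
    actDeriv E g q (s.liftDeriv B q b) = s.liftDeriv B (g • q) b := by
  have h₁ := s.liftDeriv_spec hπ hV q b
  have h₂ := s.liftDeriv_spec hπ hV (g • q) b
  refine s.eq_of_projDeriv_eq hπ hV (s.actDeriv_mem_horizontal g h₁.1) h₂.1 ?_
  rw [hπ.projDeriv_actDeriv, h₁.2, h₂.2]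

end HorizontalLift

/-! ### The discrete connection form, discrete lifts and their equivariance. -/

section DiscreteConnection

variable {Q : Type*} {K : Type*} [Group K] [MulAction K Q] {Hor Ω : Set (Q × Q)}

theorem isInvariantSet_inter {S T : Set (Q × Q)} (hS : IsInvariantSet K S)
    (hT : IsInvariantSet K T) : IsInvariantSet K (S ∩ T) :=
  fun g p hp => ⟨hS g p hp.1, hT g p hp.2⟩

theorem IsInvariantSet.smul_mem_iff {S : Set (Q × Q)} (hS : IsInvariantSet K S) (g : K)
    {q₀ q₁ : Q} : (g • q₀, g • q₁) ∈ S ↔ (q₀, q₁) ∈ S := by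
  refine ⟨fun h => ?_, fun h => hS g _ h⟩
  have h' := hS g⁻¹ _ h
  simpa using h'

theorem discreteLift_eq {q₀ q₁ : Q} {r₁ : MulAction.orbitRel.Quotient K Q}
    (hu : ∃! q', IsDiscreteLift K Hor Ω q₀ r₁ q') (h : IsDiscreteLift K Hor Ω q₀ r₁ q₁) :
    discreteLift K Hor Ω q₀ r₁ = q₁ :=
  hu.unique (@Classical.epsilon_spec_aux Q ⟨q₀⟩ _ hu.exists) h

theorem connForm_spec {p : Q × Q} (h : ∃ g : K, (p.1, g⁻¹ • p.2) ∈ Hor ∩ Ω) :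
    (p.1, (connForm K Hor Ω p)⁻¹ • p.2) ∈ Hor ∩ Ω :=
  Classical.epsilon_spec h

theorem connForm_eq {p : Q × Q} (hu : ∃! g : K, (p.1, g⁻¹ • p.2) ∈ Hor ∩ Ω) {g : K}
    (h : (p.1, g⁻¹ • p.2) ∈ Hor ∩ Ω) : connForm K Hor Ω p = g :=
  hu.unique (connForm_spec hu.exists) h

/-- Every candidate lift lies on the orbit of `q₁`, so it is `g⁻¹ q₁` for some solution `g`. -/
theorem existsUnique_isDiscreteLift {q₀ q₁ : Q}
    (hu : ∃! g : K, (q₀, g⁻¹ • q₁) ∈ Hor ∩ Ω) :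
    ∃! q', IsDiscreteLift K Hor Ω q₀ (proj K q₁) q' := by
  obtain ⟨g, hg, hguniq⟩ := hu
  refine ⟨g⁻¹ • q₁, ⟨hg, proj_smul _ _⟩, ?_⟩
  rintro q' ⟨hq', hproj⟩
  obtain ⟨h, rfl⟩ := proj_eq_proj_iff.1 hproj
  rw [← hguniq h⁻¹ (by simpa using hq'), inv_inv]

theorem isDiscreteLift_smul_iff (hinv : IsInvariantSet K (Hor ∩ Ω)) (g : K) {q₀ q₁ : Q}
    {r₁ : MulAction.orbitRel.Quotient K Q} :
    IsDiscreteLift K Hor Ω (g • q₀) r₁ (g • q₁) ↔ IsDiscreteLift K Hor Ω q₀ r₁ q₁ := by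
  simp only [IsDiscreteLift, hinv.smul_mem_iff, proj_smul]

theorem existsUnique_isDiscreteLift_smul (hinv : IsInvariantSet K (Hor ∩ Ω)) (g : K) {q₀ : Q}
    {r₁ : MulAction.orbitRel.Quotient K Q} (hu : ∃! q', IsDiscreteLift K Hor Ω q₀ r₁ q') :
    ∃! q', IsDiscreteLift K Hor Ω (g • q₀) r₁ q' := by
  obtain ⟨q₁, h₁, h₂⟩ := hu
  refine ⟨g • q₁, (isDiscreteLift_smul_iff hinv g).2 h₁, fun q' hq' => ?_⟩
  rw [← h₂ (g⁻¹ • q') ((isDiscreteLift_smul_iff hinv g).1 (by rwa [smul_inv_smul])),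
    smul_inv_smul]

/-- The conjugacy class of `e` is `{e}`, so every representative of `ρ(q, e)` has second component
`e`. -/
theorem out_rho_one (q : Q) :
    proj K (rho q (1 : K)).out.1 = proj K q ∧ (rho q (1 : K)).out.2 = 1 := by
  obtain ⟨g, h₁, h₂⟩ : ∃ g : K, g • (rho q (1 : K)).out.1 = q ∧
      g * (rho q (1 : K)).out.2 * g⁻¹ = 1 := Quotient.exact (Quotient.out_eq (rho q (1 : K)))
  exact ⟨by conv_rhs => rw [← h₁, proj_smul], by simpa using h₂⟩

/-- The representative in `Q` chosen by the reduced lagrangian over a point of `Q/K`. -/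
theorem exists_inclusionY_out_eq {q₀ : Q} (r₁ : MulAction.orbitRel.Quotient K Q) :
    ∃ g : K, (inclusionY (proj K q₀, r₁)).1.out = (g • q₀, (1 : K)) := by
  obtain ⟨h₁, h₂⟩ := out_rho_one (K := K) (proj K q₀).out
  rw [proj_out] at h₁
  obtain ⟨g, hg⟩ := proj_eq_proj_iff.1 h₁
  exact ⟨g, Prod.ext hg.symm h₂⟩

/-- The discrete lift of `π(p₁)` at `p₀` is `𝒜_d(p)⁻¹ p₁`. Invariance of `L` and of the horizontal
set removes the dependence on the chosen representative. -/
theorem Lhat_inclusionY_eq {L : Q × Q → ℝ}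
    (hL : ∀ (g : K) (q₀ q₁ : Q), L (g • q₀, g • q₁) = L (q₀, q₁))
    (hinv : IsInvariantSet K (Hor ∩ Ω)) {p : Q × Q}
    (hu : ∃! g : K, (p.1, g⁻¹ • p.2) ∈ Hor ∩ Ω) :
    Lhat L Hor Ω (inclusionY (proj K p.1, proj K p.2))
      = L (p.1, (connForm K Hor Ω p)⁻¹ • p.2) := by
  obtain ⟨g, hg⟩ := exists_inclusionY_out_eq (K := K) (q₀ := p.1) (proj K p.2)
  have hlift := existsUnique_isDiscreteLift (q₀ := p.1) (q₁ := p.2) hu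
  have h : IsDiscreteLift K Hor Ω p.1 (proj K p.2) ((connForm K Hor Ω p)⁻¹ • p.2) :=
    ⟨connForm_spec hu.exists, proj_smul _ _⟩
  simp only [Lhat, Lcheck, liftedStep, hg, one_smul]
  change L (g • p.1, discreteLift K Hor Ω (g • p.1) (proj K p.2)) = _
  rw [discreteLift_eq (existsUnique_isDiscreteLift_smul hinv g hlift)
    ((isDiscreteLift_smul_iff hinv g).2 h), hL]

variable [TopologicalSpace Q]

theorem existsUnique_of_mem_connDomain {p : Q × Q} (hp : p ∈ connDomain K Hor Ω) :
    ∃! g : K, (p.1, g⁻¹ • p.2) ∈ Hor ∩ Ω :=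
  (interior_subset hp : p ∈ {p : Q × Q | ∃! g : K, (p.1, g⁻¹ • p.2) ∈ Hor ∩ Ω})

/-- Conjugation by `g` matches the solutions at `p` with those at `g p`, so unique solvability is an
invariant condition; translations are homeomorphisms. -/
theorem isInvariantSet_connDomain (hcont : ∀ g : K, Continuous fun q : Q => g • q)
    (hinv : IsInvariantSet K (Hor ∩ Ω)) : IsInvariantSet K (connDomain K Hor Ω) := by
  intro g p hp
  have hΦ : Continuous fun p : Q × Q => (g⁻¹ • p.1, g⁻¹ • p.2) :=
    ((hcont _).comp continuous_fst).prodMk ((hcont _).comp continuous_snd)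
  refine mem_interior.2 ⟨(fun p : Q × Q => (g⁻¹ • p.1, g⁻¹ • p.2)) ⁻¹' connDomain K Hor Ω, ?_,
    isOpen_interior.preimage hΦ, ?_⟩
  · rintro p' hp'
    obtain ⟨h, hh, huniq⟩ := existsUnique_of_mem_connDomain hp'
    dsimp only at hh huniq
    have key : ∀ k : K, (p'.1, k⁻¹ • p'.2) ∈ Hor ∩ Ω ↔
        (g⁻¹ • p'.1, (g⁻¹ * k * g)⁻¹ • g⁻¹ • p'.2) ∈ Hor ∩ Ω := by
      intro k
      rw [← hinv.smul_mem_iff g⁻¹]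
      simp [smul_smul, mul_assoc]
    refine ⟨g * h * g⁻¹, (key _).2 (by simpa [mul_assoc] using hh), fun k hk => ?_⟩
    rw [← huniq _ ((key k).1 hk)]
    simp [mul_assoc]
  · simpa using hp

end DiscreteConnection

/-! ### Differentiability of the discrete connection form. -/

section Regularity

variable {E : Type*} [NormedAddCommGroup E] [NormedSpace ℝ E] [FiniteDimensional ℝ E]
  {Q : Type*} [TopologicalSpace Q] [ChartedSpace E Q] [IsManifold 𝓘(ℝ, E) ∞ Q]
  {F : Type*} [NormedAddCommGroup F] [NormedSpace ℝ F] [FiniteDimensional ℝ F]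
  {K : Type*} [Group K] [TopologicalSpace K] [ChartedSpace F K] [MulAction K Q]
  [LieGroup 𝓘(ℝ, F) ∞ K] [ContMDiffSMul 𝓘(ℝ, F) 𝓘(ℝ, E) ∞ K Q]
  {sys : DiscreteSystem E Q} {μ : GroupLieAlgebra 𝓘(ℝ, F) K →L[ℝ] ℝ} {Ω : Set (Q × Q)}

/-- The discrete connection form is differentiable at the horizontal points of its domain. -/
theorem mdifferentiableAt_connForm
    (hreg : ∀ q₀ q₁ : Q, IsRegularOnAt sys.L (verticalSpace E F K) q₀ q₁)
    (hinj : ∀ q : Q, Function.Injective (orbitDeriv E F K q)) (hΩ : IsOpen Ω)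
    {p₀ : Q × Q} (hp₀ : p₀ ∈ connDomain K (levelSet sys μ) Ω)
    (hmem : p₀ ∈ levelSet sys μ ∩ Ω) :
    MDifferentiableAt (𝓘(ℝ, E).prod 𝓘(ℝ, E)) 𝓘(ℝ, F) (connForm K (levelSet sys μ) Ω) p₀ := by
  have : IsManifold 𝓘(ℝ, F) ∞ K := inferInstance
  -- The equation `J_d(p₀, g p₁) = μ` is to be solved for `g = 𝒜_d(p)⁻¹` near `g = 1`.
  let f : (Q × Q) × K → (F →L[ℝ] ℝ) := fun x => momentum F K sys (x.1.1, x.2 • x.1.2)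
  have hf : ContMDiff ((𝓘(ℝ, E).prod 𝓘(ℝ, E)).prod 𝓘(ℝ, F)) 𝓘(ℝ, F →L[ℝ] ℝ) ∞ f :=
    (contMDiff_momentum sys).comp ((contMDiff_fst.comp contMDiff_fst).prodMk
      ((contMDiff_smul (I := 𝓘(ℝ, F)) (I' := 𝓘(ℝ, E)) (n := ∞)).comp
        (contMDiff_snd.prodMk (contMDiff_snd.comp contMDiff_fst))))
  -- The derivative in `g` is `-D₂D₁L` on vertical vectors, nondegenerate by hypothesis.
  have hfinj : Function.Injective
      (tangentDeriv 𝓘(ℝ, F) 𝓘(ℝ, F →L[ℝ] ℝ) (fun g : K => f (p₀, g)) 1) := by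
    rw [injective_iff_map_eq_zero]
    intro ξ hξ
    refine hinj p₀.2 ?_
    rw [map_zero]
    refine (hreg p₀.1 p₀.2).2 _ ⟨ξ, rfl⟩ ?_
    rintro - ⟨η, rfl⟩
    have h := tangentDeriv_momentum_smul (F := F) (K := K) sys p₀.1 p₀.2 ξ η
    have hξ' : tangentDeriv 𝓘(ℝ, F) 𝓘(ℝ, F →L[ℝ] ℝ)
      (fun g : K => momentum F K sys (p₀.1, g • p₀.2)) 1 ξ = 0 := hξ
    rw [hξ'] at h
    exact neg_eq_zero.1 h.symm
  have hdim : Module.finrank ℝ F = Module.finrank ℝ (F →L[ℝ] ℝ) := by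
    rw [← LinearEquiv.finrank_eq (LinearMap.toContinuousLinearMap (𝕜 := ℝ) (E := F) (F' := ℝ))]
    exact Subspace.dual_finrank_eq.symm
  obtain ⟨γ, hγ₁, hγ, hev⟩ := exists_implicitFunction (hf _) hfinj hdim
  have hcont : ContinuousAt (fun p : Q × Q => (p.1, γ p • p.2)) p₀ := by
    have h := (mdifferentiableAt_smul_prod E F (γ p₀, p₀.2)).continuousAt
    exact continuousAt_fst.prodMk (ContinuousAt.comp_of_eq (f := fun p : Q × Q => (γ p, p.2)) h
      (hγ.continuousAt.prodMk continuousAt_snd) rfl)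
  have hmemΩ : ∀ᶠ p in 𝓝 p₀, (p.1, γ p • p.2) ∈ Ω :=
    hcont.eventually (by dsimp only; rw [hγ₁, one_smul]; exact hΩ.mem_nhds hmem.2)
  -- Near `p₀` the implicit solution keeps the pair in `Ω`, so uniqueness on the domain identifies
  -- it with `𝒜_d⁻¹`.
  have heq : connForm K (levelSet sys μ) Ω =ᶠ[𝓝 p₀] fun p => (γ p)⁻¹ := by
    filter_upwards [hev, hmemΩ, isOpen_interior.mem_nhds hp₀] with p h₁ h₂ h₃
    refine connForm_eq (existsUnique_of_mem_connDomain h₃) ?_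
    rw [inv_inv]
    refine ⟨?_, h₂⟩
    simp only [f, one_smul] at h₁
    exact h₁.trans hmem.1
  have hinvd : MDifferentiableAt 𝓘(ℝ, F) 𝓘(ℝ, F) (fun g : K => g⁻¹) (γ p₀) :=
    (contMDiff_inv 𝓘(ℝ, F) ∞).mdifferentiableAt (by simp)
  exact (hinvd.comp p₀ hγ).congr_of_eventuallyEq heq

end Regularity

/-! ### The reduced lagrangian and force against the differential of `L`. -/

section Reduction

variable {E : Type*} [NormedAddCommGroup E] [NormedSpace ℝ E] [FiniteDimensional ℝ E]
  {Q : Type*} [TopologicalSpace Q] [ChartedSpace E Q] [IsManifold 𝓘(ℝ, E) ∞ Q]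
  {F : Type*} [NormedAddCommGroup F] [NormedSpace ℝ F]
  {K : Type*} [Group K] [TopologicalSpace K] [ChartedSpace F K] [MulAction K Q]
  [LieGroup 𝓘(ℝ, F) ∞ K] [ContMDiffSMul 𝓘(ℝ, F) 𝓘(ℝ, E) ∞ K Q]
  {B : Type*} [NormedAddCommGroup B] [NormedSpace ℝ B]
  [ChartedSpace B (MulAction.orbitRel.Quotient K Q)]
  {sys : DiscreteSystem E Q} {Hor Ω : Set (Q × Q)}
  (hL : ∀ (g : K) (q₀ q₁ : Q), sys.L (g • q₀, g • q₁) = sys.L (q₀, q₁))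
  (hinv : IsInvariantSet K (Hor ∩ Ω))

omit [FiniteDimensional ℝ E] in
include hL hinv in
/-- The derivative of the reduced lagrangian at a horizontal point. -/
theorem tangentDeriv_Lhat_inclusionY (hπ : IsPrincipalBundle E F B K Q) {q₀ q₁ : Q}
    (hdom : (q₀, q₁) ∈ connDomain K Hor Ω) (hmem : (q₀, q₁) ∈ Hor ∩ Ω)
    (hA : MDifferentiableAt (𝓘(ℝ, E).prod 𝓘(ℝ, E)) 𝓘(ℝ, F) (connForm K Hor Ω) (q₀, q₁))
    (v w : E) :
    tangentDeriv (𝓘(ℝ, B).prod 𝓘(ℝ, B)) 𝓘(ℝ, ℝ) (Lhat sys.L Hor Ω ∘ inclusionY)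
      (proj K q₀, proj K q₁) (projDeriv E K B q₀ v, projDeriv E K B q₁ w)
    = tangentDeriv (𝓘(ℝ, E).prod 𝓘(ℝ, E)) 𝓘(ℝ, ℝ) sys.L (q₀, q₁) (v, w)
      - tangentDeriv (𝓘(ℝ, E).prod 𝓘(ℝ, E)) 𝓘(ℝ, ℝ) sys.L (q₀, q₁)
        (0, orbitDeriv E F K q₁ (tangentDeriv (𝓘(ℝ, E).prod 𝓘(ℝ, E)) 𝓘(ℝ, F)
          (connForm K Hor Ω) (q₀, q₁) (v, w))) := by
  set A := connForm K Hor Ω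
  have hA₁ : A (q₀, q₁) = 1 :=
    connForm_eq (existsUnique_of_mem_connDomain hdom) (by simpa using hmem)
  have hLd : ∀ p, MDifferentiableAt (𝓘(ℝ, E).prod 𝓘(ℝ, E)) 𝓘(ℝ, ℝ) sys.L p := fun p =>
    sys.smooth_L.mdifferentiableAt (by simp)
  let n : Q × Q → Q := fun p => (A p)⁻¹ • p.2
  have hn₁ : n (q₀, q₁) = q₁ := by simp [n, hA₁]
  have hn : MDifferentiableAt (𝓘(ℝ, E).prod 𝓘(ℝ, E)) 𝓘(ℝ, E) n (q₀, q₁) := by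
    have h₁ : MDifferentiableAt (𝓘(ℝ, E).prod 𝓘(ℝ, E)) 𝓘(ℝ, F) (fun p => (A p)⁻¹) (q₀, q₁) :=
      ((contMDiff_inv 𝓘(ℝ, F) ∞).mdifferentiableAt (by simp)).comp (q₀, q₁) hA
    exact MDifferentiableAt.comp (q₀, q₁) (g := fun p : K × Q => p.1 • p.2)
      (mdifferentiableAt_smul_prod E F _) (h₁.prodMk mdifferentiableAt_snd)
  -- Obtained from `𝒜_d(p) n(p) = p₁` by the product rule, which avoids differentiating the group
  -- inverse.
  have hndiff : tangentDeriv (𝓘(ℝ, E).prod 𝓘(ℝ, E)) 𝓘(ℝ, E) n (q₀, q₁) (v, w)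
      = w - orbitDeriv E F K q₁
        (tangentDeriv (𝓘(ℝ, E).prod 𝓘(ℝ, E)) 𝓘(ℝ, F) A (q₀, q₁) (v, w)) := by
    have h := tangentDeriv_smul (c := n) hA hn (v, w)
    have hs : (fun p : Q × Q => A p • n p) = fun p => p.2 := by
      funext p
      exact smul_inv_smul _ _
    rw [hs, tangentDeriv_snd, hA₁, hn₁, actDeriv_one] at h
    exact eq_sub_of_add_eq' h.symm
  let m : Q × Q → ℝ := fun p => sys.L (p.1, n p)
  have hm : MDifferentiableAt (𝓘(ℝ, E).prod 𝓘(ℝ, E)) 𝓘(ℝ, ℝ) m (q₀, q₁) :=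
    MDifferentiableAt.comp (q₀, q₁) (g := sys.L) (hLd _) (mdifferentiableAt_fst.prodMk hn)
  have hmdiff : tangentDeriv (𝓘(ℝ, E).prod 𝓘(ℝ, E)) 𝓘(ℝ, ℝ) m (q₀, q₁) (v, w)
      = tangentDeriv (𝓘(ℝ, E).prod 𝓘(ℝ, E)) 𝓘(ℝ, ℝ) sys.L (q₀, q₁)
        (v, w - orbitDeriv E F K q₁
          (tangentDeriv (𝓘(ℝ, E).prod 𝓘(ℝ, E)) 𝓘(ℝ, F) A (q₀, q₁) (v, w))) := by
    rw [tangentDeriv_comp (g := sys.L) (f := fun p : Q × Q => (p.1, n p)) (y := (q₀, q₁))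
      (by simp only [hn₁]) (hLd _) (mdifferentiableAt_fst.prodMk hn),
      tangentDeriv_prodMk mdifferentiableAt_fst hn, tangentDeriv_fst, hndiff]
  let ℓ : MulAction.orbitRel.Quotient K Q × MulAction.orbitRel.Quotient K Q → ℝ :=
    Lhat sys.L Hor Ω ∘ inclusionY
  have hℓm : ∀ p ∈ connDomain K Hor Ω, ℓ (proj K p.1, proj K p.2) = m p := fun p hp =>
    Lhat_inclusionY_eq hL hinv (existsUnique_of_mem_connDomain hp)
  -- Local sections express `L̆` as `m ∘ χ` near the base point; this proves it differentiable, as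
  -- the chain rule below requires.
  obtain ⟨σ, hσ, hσ₁, hσe⟩ := hπ.exists_section q₀
  obtain ⟨τ, hτ, hτ₁, hτe⟩ := hπ.exists_section q₁
  let χ : MulAction.orbitRel.Quotient K Q × MulAction.orbitRel.Quotient K Q → Q × Q :=
    fun x => (σ x.1, τ x.2)
  have hχ₁ : χ (proj K q₀, proj K q₁) = (q₀, q₁) := by simp only [χ, hσ₁, hτ₁]
  have hχ : MDifferentiableAt (𝓘(ℝ, B).prod 𝓘(ℝ, B)) (𝓘(ℝ, E).prod 𝓘(ℝ, E)) χ
      (proj K q₀, proj K q₁) :=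
    (MDifferentiableAt.comp (proj K q₀, proj K q₁) (g := σ) hσ mdifferentiableAt_fst).prodMk
      (MDifferentiableAt.comp (proj K q₀, proj K q₁) (g := τ) hτ mdifferentiableAt_snd)
  have hℓe : ℓ =ᶠ[𝓝 (proj K q₀, proj K q₁)] fun x => m (χ x) := by
    have h₁ : ∀ᶠ x in 𝓝 (proj K q₀, proj K q₁), χ x ∈ connDomain K Hor Ω :=
      hχ.continuousAt.eventually (by rw [hχ₁]; exact isOpen_interior.mem_nhds hdom)
    have h₂ := continuousAt_fst (p := (proj K q₀, proj K q₁)).eventually hσe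
    have h₃ := continuousAt_snd (p := (proj K q₀, proj K q₁)).eventually hτe
    filter_upwards [h₁, h₂, h₃] with x h₁ h₂ h₃
    rw [← hℓm _ h₁]
    simp only [χ, h₂, h₃]
  have hℓ : MDifferentiableAt (𝓘(ℝ, B).prod 𝓘(ℝ, B)) 𝓘(ℝ, ℝ) ℓ (proj K q₀, proj K q₁) :=
    (MDifferentiableAt.comp_of_eq _ hm hχ hχ₁).congr_of_eventuallyEq hℓe
  have hp₀ : MDifferentiableAt (𝓘(ℝ, E).prod 𝓘(ℝ, E)) 𝓘(ℝ, B) (fun p : Q × Q => proj K p.1)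
      (q₀, q₁) :=
    MDifferentiableAt.comp (q₀, q₁) (hπ.mdifferentiableAt_proj q₀) mdifferentiableAt_fst
  have hp₁ : MDifferentiableAt (𝓘(ℝ, E).prod 𝓘(ℝ, E)) 𝓘(ℝ, B) (fun p : Q × Q => proj K p.2)
      (q₀, q₁) :=
    MDifferentiableAt.comp (q₀, q₁) (hπ.mdifferentiableAt_proj q₁) mdifferentiableAt_snd
  have h := tangentDeriv_comp (g := ℓ) (f := fun p : Q × Q => (proj K p.1, proj K p.2))
    (x := (q₀, q₁)) rfl hℓ (hp₀.prodMk hp₁) (v, w)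
  rw [tangentDeriv_congr (g := m) (Filter.eventually_of_mem (isOpen_interior.mem_nhds hdom) hℓm),
    hmdiff, tangentDeriv_prodMk hp₀ hp₁,
    tangentDeriv_comp (g := (proj K : Q → _)) (f := fun p : Q × Q => p.1) rfl
      (hπ.mdifferentiableAt_proj q₀) mdifferentiableAt_fst,
    tangentDeriv_comp (g := (proj K : Q → _)) (f := fun p : Q × Q => p.2) rfl
      (hπ.mdifferentiableAt_proj q₁) mdifferentiableAt_snd,
    tangentDeriv_fst, tangentDeriv_snd] at h
  refine h.symm.trans ?_
  rw [← map_sub, Prod.mk_sub_mk, sub_zero]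

variable (s : Splitting F K sys)

/-- The reduced force as a `1`-form on the model vector space. -/
def reducedForce (B : Type*) [NormedAddCommGroup B] [NormedSpace ℝ B]
    [ChartedSpace B (MulAction.orbitRel.Quotient K Q)] (Hor Ω : Set (Q × Q))
    (p : MulAction.orbitRel.Quotient K Q × MulAction.orbitRel.Quotient K Q) : (B × B) →L[ℝ] ℝ :=
  (reducedSystem B s Hor Ω).f p

omit [FiniteDimensional ℝ E] [LieGroup 𝓘(ℝ, F) ∞ K] in
/-- The reduced force in terms of the representative chosen in its definition. -/
theorem reducedForce_apply {q₀ q₁ : Q} {r₁ : MulAction.orbitRel.Quotient K Q}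
    (hout : (inclusionY (proj K q₀, r₁)).1.out = (q₀, (1 : K)))
    (hlift : discreteLift K Hor Ω q₀ r₁ = q₁) (b₀ b₁ : B) :
    reducedForce s B Hor Ω (proj K q₀, r₁) (b₀, b₁)
      = tangentDeriv (𝓘(ℝ, E).prod 𝓘(ℝ, E)) 𝓘(ℝ, ℝ) sys.L (q₀, q₁)
        (0, orbitDeriv E F K q₁ (tangentDeriv (𝓘(ℝ, E).prod 𝓘(ℝ, E)) 𝓘(ℝ, F)
          (connForm K Hor Ω) (q₀, q₁) (s.liftDeriv B q₀ b₀, s.liftDeriv B q₁ b₁))) := by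
  have h : ∀ z : ConjBundle K Q × MulAction.orbitRel.Quotient K Q,
      (Fhat (B := B) s Hor Ω z : (B × B) →L[ℝ] ℝ) (b₀, b₁)
      = tangentDeriv 𝓘(ℝ, F) 𝓘(ℝ, ℝ) (fun w : K => Lcheck sys.L Hor Ω z.1.out.1 w z.2) z.1.out.2
        (tangentDeriv (𝓘(ℝ, E).prod 𝓘(ℝ, E)) 𝓘(ℝ, F) (connForm K Hor Ω)
          (z.1.out.1, liftedStep Hor Ω z.1.out.1 z.1.out.2 z.2)
          (s.liftDeriv B z.1.out.1 b₀,
            s.liftDeriv B (liftedStep Hor Ω z.1.out.1 z.1.out.2 z.2) b₁)) := fun z => rfl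
  refine (h _).trans ?_
  rw [hout]
  have hz : (inclusionY (proj K q₀, r₁) : ConjBundle K Q × _).2 = r₁ := rfl
  simp only [hz, Lcheck, liftedStep, hlift, one_smul]
  rw [tangentDeriv_comp (g := sys.L) (f := fun w : K => (q₀, w • q₁)) (y := (q₀, q₁))
    (by simp) (sys.smooth_L.mdifferentiableAt (by simp))
    (mdifferentiableAt_const.prodMk (mdifferentiableAt_smul_right E F _ _)),
    tangentDeriv_prodMk mdifferentiableAt_const (mdifferentiableAt_smul_right E F _ _),
    tangentDeriv_const]
  rfl

include hL hinv in
/-- The differential of the reduced lagrangian plus the reduced force is the differential of the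
lagrangian on horizontal lifts. -/
theorem tangentDeriv_Lhat_add_reducedForce (hπ : IsPrincipalBundle E F B K Q)
    (hV : ∀ q, verticalSpace E F K q ≤ sys.D q)
    (hA : ∀ p ∈ connDomain K Hor Ω, p ∈ Hor ∩ Ω →
      MDifferentiableAt (𝓘(ℝ, E).prod 𝓘(ℝ, E)) 𝓘(ℝ, F) (connForm K Hor Ω) p)
    {q₀ q₁ : Q} (hdom : (q₀, q₁) ∈ connDomain K Hor Ω) (hmem : (q₀, q₁) ∈ Hor ∩ Ω)
    (b₀ b₁ : B) :
    tangentDeriv (𝓘(ℝ, B).prod 𝓘(ℝ, B)) 𝓘(ℝ, ℝ) (Lhat sys.L Hor Ω ∘ inclusionY)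
      (proj K q₀, proj K q₁) (b₀, b₁)
      + reducedForce s B Hor Ω (proj K q₀, proj K q₁) (b₀, b₁)
    = tangentDeriv (𝓘(ℝ, E).prod 𝓘(ℝ, E)) 𝓘(ℝ, ℝ) sys.L (q₀, q₁)
        (s.liftDeriv B q₀ b₀, s.liftDeriv B q₁ b₁) := by
  -- The force is computed at its chosen representative `g q₀`, so the identity is proved at `(g q₀,
  -- g q₁)` and carried back by invariance.
  obtain ⟨g, hg⟩ := exists_inclusionY_out_eq (K := K) (q₀ := q₀) (proj K q₁)
  have hdom' := isInvariantSet_connDomain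
    (fun g => (contMDiff_smul_left E F (K := K) g).continuous) hinv g _ hdom
  have hmem' := hinv g _ hmem
  have h₁ := tangentDeriv_Lhat_inclusionY hL hinv hπ hdom' hmem' (hA _ hdom' hmem')
    (s.liftDeriv B (g • q₀) b₀) (s.liftDeriv B (g • q₁) b₁)
  have h₂ := reducedForce_apply (B := B) (Hor := Hor) (Ω := Ω) (q₁ := g • q₁) s
    (q₀ := g • q₀) (r₁ := proj K q₁) (by rw [proj_smul]; exact hg)
    (discreteLift_eq (existsUnique_isDiscreteLift_smul hinv g
      (existsUnique_isDiscreteLift (existsUnique_of_mem_connDomain hdom)))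
      ((isDiscreteLift_smul_iff hinv g).2 ⟨hmem, rfl⟩)) b₀ b₁
  dsimp only at h₁
  rw [(s.liftDeriv_spec hπ hV _ _).2, (s.liftDeriv_spec hπ hV _ _).2] at h₁
  simp only [proj_smul] at h₁ h₂
  rw [h₁, h₂, sub_add_cancel, ← s.actDeriv_liftDeriv hπ hV, ← s.actDeriv_liftDeriv hπ hV,
    tangentDeriv_actDeriv F sys.smooth_L hL]

end Reduction

/-! ### Lifting the constraints and the variational equations. -/

section Reconstruction

variable {E : Type*} [NormedAddCommGroup E] [NormedSpace ℝ E]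
  {Q : Type*} [TopologicalSpace Q] [ChartedSpace E Q] [IsManifold 𝓘(ℝ, E) ∞ Q]
  {F : Type*} [NormedAddCommGroup F] [NormedSpace ℝ F]
  {K : Type*} [Group K] [TopologicalSpace K] [ChartedSpace F K] [MulAction K Q]
  {B : Type*} [NormedAddCommGroup B] [NormedSpace ℝ B]
  [ChartedSpace B (MulAction.orbitRel.Quotient K Q)]
  {sys : DiscreteSystem E Q} {Hor Ω : Set (Q × Q)}

omit [TopologicalSpace K] in
/-- A pair of points of `Q/K` satisfying the reduced kinematic constraints lifts, from any point
over the first one, to a horizontal pair satisfying the kinematic constraints. -/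
theorem exists_lift_of_mem_Ddhat (hcont : ∀ g : K, Continuous fun q : Q => g • q)
    (hinv : IsInvariantSet K (Hor ∩ Ω)) {Dd : Set (Q × Q)} (hDd : IsInvariantSet K Dd)
    {q₀ : Q} {r₁ : MulAction.orbitRel.Quotient K Q}
    (h : inclusionY (proj K q₀, r₁) ∈ Ddhat K Hor Ω Dd) :
    ∃ q₁ : Q, (q₀, q₁) ∈ Dd ∧ (q₀, q₁) ∈ connDomain K Hor Ω ∧ (q₀, q₁) ∈ Hor ∩ Ω ∧
      proj K q₁ = r₁ := by
  obtain ⟨p, ⟨hp, hpdom⟩, hΥ⟩ := h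
  obtain ⟨h₁, h₂⟩ := Prod.ext_iff.1 hΥ
  obtain ⟨g, hg, hgA⟩ : ∃ g : K, g • p.1 = (proj K q₀).out ∧
    g * connForm K Hor Ω p * g⁻¹ = 1 := Quotient.exact h₁
  -- Being conjugate to `e`, the connection form is `e`, so `p` itself is horizontal.
  have hA : connForm K Hor Ω p = 1 := by simpa using hgA
  have hmem := connForm_spec (existsUnique_of_mem_connDomain hpdom).exists
  rw [hA, inv_one, one_smul] at hmem
  obtain ⟨k, rfl⟩ : ∃ k : K, k • p.1 = q₀ := by
    rw [← proj_eq_proj_iff, ← proj_smul g p.1, hg, proj_out]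
  exact ⟨k • p.2, hDd k _ hp, isInvariantSet_connDomain hcont hinv k _ hpdom, hinv k _ hmem,
    (proj_smul k p.2).trans h₂⟩

variable [ContMDiffSMul 𝓘(ℝ, F) 𝓘(ℝ, E) ∞ K Q]

theorem projDeriv_mem_reducedSystem_D (hπ : IsPrincipalBundle E F B K Q)
    (hD : IsInvariantDistribution K sys.D) (s : Splitting F K sys) {q : Q}
    {r : MulAction.orbitRel.Quotient K Q} (hr : proj K q = r) {v : E} (hv : v ∈ sys.D q) :
    projDeriv E K B q v ∈ (reducedSystem B s Hor Ω).D r := by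
  obtain ⟨g, hg⟩ : ∃ g : K, g • q = r.out := by
    rw [← proj_eq_proj_iff, proj_out, hr]
  have h : ∀ x : Q, g • q = x → ∃ u ∈ sys.D x, projDeriv E K B x u = projDeriv E K B q v := by
    rintro _ rfl
    exact ⟨actDeriv E g q v, hD g q v hv, hπ.projDeriv_actDeriv g q v⟩
  obtain ⟨u, hu, hu'⟩ := h _ hg
  exact ⟨u, hu, hu'⟩

/-- Along a pair of points with momentum `μ`, the differential of the lagrangian on vertical
vectors is a difference of values of `μ`. -/
theorem tangentDeriv_vertical
    (hL : ∀ (g : K) (q₀ q₁ : Q), sys.L (g • q₀, g • q₁) = sys.L (q₀, q₁)) (q₀ q₁ : Q) (ξ η : F) :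
    tangentDeriv (𝓘(ℝ, E).prod 𝓘(ℝ, E)) 𝓘(ℝ, ℝ) sys.L (q₀, q₁)
      (orbitDeriv E F K q₀ ξ, orbitDeriv E F K q₁ η)
    = momentum F K sys (q₀, q₁) η - momentum F K sys (q₀, q₁) ξ := by
  have h : (orbitDeriv E F K q₀ ξ, orbitDeriv E F K q₁ η)
      = (orbitDeriv E F K q₀ η, orbitDeriv E F K q₁ η)
        - ((orbitDeriv E F K q₀ η, 0) - (orbitDeriv E F K q₀ ξ, 0)) := by simp
  rw [h, map_sub, map_sub, tangentDeriv_orbitDeriv sys.smooth_L hL, momentum_apply, momentum_apply]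
  ring

theorem sum_succ_sub_castSucc {N : ℕ} (c : Fin (N + 1) → ℝ) :
    ∑ k : Fin N, (c k.succ - c k.castSucc) = c (Fin.last N) - c 0 := by
  rw [Finset.sum_sub_distrib]
  linarith [Fin.sum_univ_succ c, Fin.sum_univ_castSucc c]

omit [TopologicalSpace Q] [TopologicalSpace K] in
theorem liftedCurve_succ {q₀ : Q} {N : ℕ} (r : Fin (N + 1) → MulAction.orbitRel.Quotient K Q)
    (k : Fin N) : liftedCurve K Hor Ω q₀ r k.succ
      = discreteLift K Hor Ω (liftedCurve K Hor Ω q₀ r k.castSucc) (r k.succ) :=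
  Fin.induction_succ ..

variable [LieGroup 𝓘(ℝ, F) ∞ K] [FiniteDimensional ℝ E]

/-- A curve of horizontal pairs with fixed momentum, satisfying the kinematic constraints and lying
over a trajectory of the reduced system, is a trajectory. -/
theorem isTrajectory_of_isTrajectory_reducedSystem (hπ : IsPrincipalBundle E F B K Q)
    (hL : ∀ (g : K) (q₀ q₁ : Q), sys.L (g • q₀, g • q₁) = sys.L (q₀, q₁))
    (hD : IsInvariantDistribution K sys.D)
    (hfree : ∀ (g : K) (q : Q), g • q = q → g = 1)
    (hV : ∀ q, verticalSpace E F K q ≤ sys.D q) (s : Splitting F K sys)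
    (hinv : IsInvariantSet K (Hor ∩ Ω))
    (hA : ∀ p ∈ connDomain K Hor Ω, p ∈ Hor ∩ Ω →
      MDifferentiableAt (𝓘(ℝ, E).prod 𝓘(ℝ, E)) 𝓘(ℝ, F) (connForm K Hor Ω) p)
    (μ : F →L[ℝ] ℝ) {N : ℕ} {r : Fin (N + 1) → MulAction.orbitRel.Quotient K Q}
    (hr : (reducedSystem B s Hor Ω).IsTrajectory r) {q : Fin (N + 1) → Q}
    (hqr : ∀ k, proj K (q k) = r k)
    (hDd : ∀ k : Fin N, (q k.castSucc, q k.succ) ∈ sys.Dd)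
    (hdom : ∀ k : Fin N, (q k.castSucc, q k.succ) ∈ connDomain K Hor Ω)
    (hmem : ∀ k : Fin N, (q k.castSucc, q k.succ) ∈ Hor ∩ Ω)
    (hμ : ∀ k : Fin N, momentum F K sys (q k.castSucc, q k.succ) = μ) :
    sys.IsTrajectory q := by
  refine ⟨hDd, ?_⟩
  rintro (δ : Fin (N + 1) → E) ⟨hδ₀, hδN, hδ⟩
  obtain rfl : r = fun k => proj K (q k) := funext fun k => (hqr k).symm
  let b : Fin (N + 1) → B := fun k => projDeriv E K B (q k) (δ k)
  let h : Fin (N + 1) → E := fun k => s.liftDeriv B (q k) (b k)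
  have hb : ∀ k, δ k = 0 → b k = 0 := fun k hk => by simp only [b, hk, map_zero]
  have hadm : IsAdmissibleVariation (reducedSystem B s Hor Ω).D (fun k => proj K (q k)) b :=
    ⟨hb _ hδ₀, hb _ hδN, fun k => projDeriv_mem_reducedSystem_D hπ hD s rfl (hδ k)⟩
  have hhor : ∑ k : Fin N, tangentDeriv (𝓘(ℝ, E).prod 𝓘(ℝ, E)) 𝓘(ℝ, ℝ) sys.L
      (q k.castSucc, q k.succ) (h k.castSucc, h k.succ) = 0 := by
    have h₁ : ∑ k : Fin N, tangentDeriv (𝓘(ℝ, B).prod 𝓘(ℝ, B)) 𝓘(ℝ, ℝ)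
          (Lhat sys.L Hor Ω ∘ inclusionY) (proj K (q k.castSucc), proj K (q k.succ))
          (b k.castSucc, b k.succ)
        + ∑ k : Fin N, reducedForce s B Hor Ω (proj K (q k.castSucc), proj K (q k.succ))
          (b k.castSucc, b k.succ) = 0 := hr.2 b hadm
    rw [← Finset.sum_add_distrib] at h₁
    rw [← h₁]
    exact Finset.sum_congr rfl fun k _ =>
      (tangentDeriv_Lhat_add_reducedForce hL hinv s hπ hV hA (hdom k) (hmem k) _ _).symm
  have hvert : ∀ k, ∃ ξ : F, orbitDeriv E F K (q k) ξ = δ k - h k := fun k =>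
    hπ.exists_orbitDeriv_eq (by rw [map_sub, (s.liftDeriv_spec hπ hV _ _).2, sub_self])
  choose ξ hξ using hvert
  -- Injectivity of `ξ ↦ ξ_Q` makes the end terms of the telescoping sum vanish.
  have hξ₀ : ∀ k, δ k = 0 → ξ k = 0 := fun k hk => by
    refine hπ.orbitDeriv_injective hfree (q k) ?_
    rw [hξ, map_zero, hk]
    simp only [h, hb k hk, map_zero, sub_zero]
  have hstep : ∀ k : Fin N, tangentDeriv (𝓘(ℝ, E).prod 𝓘(ℝ, E)) 𝓘(ℝ, ℝ) sys.L
      (q k.castSucc, q k.succ) (δ k.castSucc, δ k.succ)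
      = tangentDeriv (𝓘(ℝ, E).prod 𝓘(ℝ, E)) 𝓘(ℝ, ℝ) sys.L
        (q k.castSucc, q k.succ) (h k.castSucc, h k.succ)
        + (μ (ξ k.succ) - μ (ξ k.castSucc)) := by
    intro k
    rw [← hμ k, ← tangentDeriv_vertical hL, hξ, hξ, ← map_add, Prod.mk_add_mk,
      add_sub_cancel, add_sub_cancel]
  refine (Finset.sum_congr rfl fun k _ => hstep k).trans ?_
  rw [Finset.sum_add_distrib, hhor, sum_succ_sub_castSucc (fun k => μ (ξ k)), hξ₀ _ hδ₀,
    hξ₀ _ hδN, sub_self, add_zero]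

end Reconstruction

theorem IsHorizontalSymmetryGroup.contMDiffSMul {E Q F' F M : Type*}
    [NormedAddCommGroup E] [NormedSpace ℝ E]
    [TopologicalSpace Q] [ChartedSpace E Q] [IsManifold 𝓘(ℝ, E) ∞ Q]
    [NormedAddCommGroup F'] [NormedSpace ℝ F'] [NormedAddCommGroup F] [NormedSpace ℝ F]
    [Group M] [TopologicalSpace M] [ChartedSpace F' M] [MulAction M Q]
    {G : Subgroup M} [ChartedSpace F G] {sys : DiscreteSystem E Q}
    (hG : IsHorizontalSymmetryGroup F' F G sys) : ContMDiffSMul 𝓘(ℝ, F) 𝓘(ℝ, E) ∞ G Q :=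
  ⟨hG.symmetry.smooth.contMDiff_smul.comp
    ((hG.smooth_incl.comp contMDiff_fst).prodMk contMDiff_snd)⟩

end DiscreteMechanics

end

/-! ### The reconstruction theorem. -/

theorem mainTheorem8
    {E : Type*} [NormedAddCommGroup E] [NormedSpace ℝ E] [FiniteDimensional ℝ E]
    {Q : Type*} [TopologicalSpace Q] [T2Space Q] [SecondCountableTopology Q]
    [ChartedSpace E Q] [IsManifold 𝓘(ℝ, E) ∞ Q]
    {F' : Type*} [NormedAddCommGroup F'] [NormedSpace ℝ F'] [FiniteDimensional ℝ F']
    {M : Type*} [Group M] [TopologicalSpace M] [ChartedSpace F' M] [LieGroup 𝓘(ℝ, F') ∞ M]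
    [MulAction M Q]
    {F : Type*} [NormedAddCommGroup F] [NormedSpace ℝ F] [FiniteDimensional ℝ F]
    (G : Subgroup M) [ChartedSpace F G] [LieGroup 𝓘(ℝ, F) ∞ G]
    {B : Type*} [NormedAddCommGroup B] [NormedSpace ℝ B] [FiniteDimensional ℝ B]
    [ChartedSpace B (MulAction.orbitRel.Quotient G Q)]
    [IsManifold 𝓘(ℝ, B) ∞ (MulAction.orbitRel.Quotient G Q)]
    (hπ : DiscreteMechanics.IsPrincipalBundle E F B G Q)
    (sys : DiscreteMechanics.DiscreteSystem E Q)
    (hG : DiscreteMechanics.IsHorizontalSymmetryGroup F' F G sys)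
    (s : DiscreteMechanics.Splitting F G sys)
    (qbar₀ qbar₁ : Q) (hqbar : (qbar₀, qbar₁) ∈ sys.Dd)
    (μ : GroupLieAlgebra 𝓘(ℝ, F) G →L[ℝ] ℝ)
    (hμ : μ = DiscreteMechanics.Jd F G sys qbar₀ qbar₁)
    (hAd : ∀ g : G, DiscreteMechanics.coAd g μ = μ)
    (hgood : DiscreteMechanics.IsGood sys μ)
    (Ω : Set (Q × Q))
    (hΩ : DiscreteMechanics.IsLevelNeighborhood G (DiscreteMechanics.levelSet sys μ) Ω)
    (hqbarΩ : (qbar₀, qbar₁) ∈ Ω)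
    (N : ℕ) (hN : 1 ≤ N) (r : Fin (N + 1) → MulAction.orbitRel.Quotient G Q)
    (hr : (DiscreteMechanics.reducedSystem B s
      (DiscreteMechanics.levelSet sys μ) Ω).IsTrajectory r)
    (hr₀ : DiscreteMechanics.proj G qbar₀ = r 0)
    (hr₁ : DiscreteMechanics.proj G qbar₁ = r ⟨1, Nat.lt_succ_of_le hN⟩) :
    let q : Fin (N + 1) → Q :=
      DiscreteMechanics.liftedCurve G (DiscreteMechanics.levelSet sys μ) Ω qbar₀ r
    (∀ k : Fin N, ∃! q' : Q, DiscreteMechanics.IsDiscreteLift G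
      (DiscreteMechanics.levelSet sys μ) Ω (q k.castSucc) (r k.succ) q') ∧
    sys.IsTrajectory q ∧ q 0 = qbar₀ ∧ q ⟨1, Nat.lt_succ_of_le hN⟩ = qbar₁ := by
  open DiscreteMechanics in
  have hsmul : ContMDiffSMul 𝓘(ℝ, F) 𝓘(ℝ, E) ∞ G Q := hG.contMDiffSMul
  have hL : ∀ (g : G) (q₀ q₁ : Q), sys.L (g • q₀, g • q₁) = sys.L (q₀, q₁) := fun g =>
    hG.symmetry.L_invariant g
  have hfree : ∀ (g : G) (q : Q), g • q = q → g = 1 := fun g q h =>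
    Subtype.ext (hG.symmetry.free g q h)
  have hD : IsInvariantDistribution G sys.D := fun g => hG.symmetry.D_invariant g
  have hDd : IsInvariantSet G sys.Dd := fun g => hG.symmetry.Dd_invariant g
  have hV : ∀ q, verticalSpace E F G q ≤ sys.D q := fun q => by
    rw [← hG.horizontal q]
    exact inf_le_right
  have hinv : IsInvariantSet G (levelSet sys μ ∩ Ω) :=
    isInvariantSet_inter (fun g _ h => smul_mem_levelSet hL hAd g h) hΩ.invariant
  have hcont : ∀ g : G, Continuous fun q : Q => g • q := fun g =>
    (contMDiff_smul_left E F g).continuous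
  have hA := fun p hp hmem => mdifferentiableAt_connForm (μ := μ) (p₀ := p) hgood.group_regular
    (hπ.orbitDeriv_injective hfree) hΩ.isOpen hp hmem
  intro q
  have hlift : ∀ k : Fin N, proj G (q k.castSucc) = r k.castSucc →
      ∃ q₁, (q k.castSucc, q₁) ∈ sys.Dd ∧ (q k.castSucc, q₁) ∈ connDomain G (levelSet sys μ) Ω ∧
        (q k.castSucc, q₁) ∈ levelSet sys μ ∩ Ω ∧ proj G q₁ = r k.succ := fun k hk =>
    exists_lift_of_mem_Ddhat hcont hinv hDd (by rw [hk]; exact hr.1 k)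
  have huniq : ∀ {q₀ q₁ : Q} {r₁ : MulAction.orbitRel.Quotient G Q},
      (q₀, q₁) ∈ connDomain G (levelSet sys μ) Ω → proj G q₁ = r₁ →
      ∃! q', IsDiscreteLift G (levelSet sys μ) Ω q₀ r₁ q' := by
    rintro q₀ q₁ _ h rfl
    exact existsUnique_isDiscreteLift (existsUnique_of_mem_connDomain h)
  have hsucc : ∀ k : Fin N, q k.succ
      = discreteLift G (levelSet sys μ) Ω (q k.castSucc) (r k.succ) := liftedCurve_succ r
  -- Induction is needed because the lift at step `k` is known to exist only once `qₖ` lies over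
  -- `rₖ`.
  have hqr : ∀ k, proj G (q k) = r k := by
    intro k
    induction k using Fin.induction with
    | zero => exact hr₀
    | succ k ih =>
      obtain ⟨q₁, -, hdom, hmem, hproj⟩ := hlift k ih
      rw [hsucc, discreteLift_eq (huniq hdom hproj) ⟨hmem, hproj⟩, hproj]
  have hstep : ∀ k : Fin N, (q k.castSucc, q k.succ) ∈ sys.Dd ∧
      (q k.castSucc, q k.succ) ∈ connDomain G (levelSet sys μ) Ω ∧
      (q k.castSucc, q k.succ) ∈ levelSet sys μ ∩ Ω := by
    intro k
    obtain ⟨q₁, hDd, hdom, hmem, hproj⟩ := hlift k (hqr _)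
    rw [hsucc, discreteLift_eq (huniq hdom hproj) ⟨hmem, hproj⟩]
    exact ⟨hDd, hdom, hmem⟩
  have hexu : ∀ k : Fin N, ∃! q', IsDiscreteLift G (levelSet sys μ) Ω (q k.castSucc) (r k.succ) q' :=
    fun k => huniq (hstep k).2.1 (hqr _)
  refine ⟨hexu, isTrajectory_of_isTrajectory_reducedSystem hπ hL hD hfree hV s hinv hA μ hr hqr
    (fun k => (hstep k).1) (fun k => (hstep k).2.1) (fun k => (hstep k).2.2)
    (fun k => (hstep k).2.2.1), rfl, ?_⟩
  -- The pair `(q̄₀, q̄₁)` has momentum `μ` and lies in `Ω`, so `q̄₁` is the unique lift of `r₁` at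
  -- `q̄₀`.
  exact (hsucc ⟨0, hN⟩).trans (discreteLift_eq (hexu ⟨0, hN⟩) ⟨⟨hμ.symm, hqbarΩ⟩, hr₁⟩)
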